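/- Let $M$ be a connected smooth ($C^\infty$, finite-dimensional, Hausdorff, without boundary) manifold, $\pi:V\to M$ a smooth real vector bundle of finite rank, and $J^m=J^m\pi$ the bundle of $m$-jets of its sections, with projections $\pi_{m,i}:J^m\to J^i$ for $i\le m$. Let $\mathcal E_k\subset J^k$ be a linear differential equation of order $k$, that is, a smooth vector subbundle of $J^k$. For $m\ge k$ let $\mathcal E_m=\mathcal E_k^{(m-k)}\subset J^m$ be its prolongation: the fibre $\mathcal E_m(x)$ consists of the $m$-jets $j^m_xs$ that satisfy at $x$ all scalar linear equations of order at most $k$ vanishing on $\mathcal E_k$, together with all their derivatives of order at most $m-k$; for $m<k$ put $\mathcal E_m=J^m$. Let $$\bar{\mathcal E}_i(x)=\bigcap_{m\ge i}\pi_{m,i}(\mathcal E_m(x)),\qquad \bar g_i(x)=\operatorname{Ker}\bigl(\pi_{i,i-1}:\bar{\mathcal E}_i(x)\to\bar{\mathcal E}_{i-1}(x)\bigr)\ (i\ge1),\qquad \bar g_0(x)=\bar{\mathcal E}_0(x),$$ where the dimensions of these spaces may depend on $x\in M$. Let $\operatorname{Sol}(\mathcal E)$ be the real vector space of global smooth solutions,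 i.e. of the smooth sections $s$ of $V$ over $M$ with $j^k_xs\in\mathcal E_k(x)$ for all $x\in M$. Suppose that there is a number $l\ge\max(k,1)$ such that the projection $\pi_{l,l-1}:\mathcal E_l\to\mathcal E_{l-1}$ is injective (over every point of $M$). Then: 1. $\pi_{i,i-1}:\mathcal E_i\to\mathcal E_{i-1}$ is injective for all $i\ge l$; 2. no nonzero solution is flat at any point: if $s\in\operatorname{Sol}(\mathcal E)$ and $j^m_xs=0$ for all $m$ at some point $x\in M$, then $s=0$; 3. $$\dim\operatorname{Sol}(\mathcal E)\le\inf_{x\in M}\sum_{i=0}^\infty\dim\bar g_i(x).$$ -/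

import Mathlib

open Bundle Topology
open scoped Manifold ContDiff ENat

noncomputable section

namespace LinearPDE

section

variable (E : Type*) [NormedAddCommGroup E] [NormedSpace ℝ E]
  {M : Type*} [TopologicalSpace M] [ChartedSpace E M]
  (F : Type*) [NormedAddCommGroup F] [NormedSpace ℝ F]
  (V : M → Type*) [TopologicalSpace (TotalSpace F V)]
  [∀ x, AddCommGroup (V x)] [∀ x, Module ℝ (V x)] [∀ x, TopologicalSpace (V x)]
  [FiberBundle F V] [VectorBundle ℝ F V]

/-- The real vector space of global smooth sections of the vector bundle `V → M` with model
fibre `F`, over the boundaryless manifold `M` modelled on `E`. -/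
abbrev Sec := ContMDiffSection 𝓘(ℝ, E) F ∞ V

/-- The algebra of smooth real functions on `M`. -/
abbrev Fun (M : Type*) [TopologicalSpace M] [ChartedSpace E M] :=
  ContMDiffMap 𝓘(ℝ, E) 𝓘(ℝ, ℝ) M ℝ ∞

variable {E F V}

/-- The coordinate expression of a section in the preferred chart and the preferred
trivialization at `x`. -/
def localRep (s : Sec E F V) (x : M) : E → F := fun z =>
  (trivializationAt F V x).continuousLinearMapAt ℝ ((extChartAt 𝓘(ℝ, E) x).symm z)
    (s ((extChartAt 𝓘(ℝ, E) x).symm z))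

/-- The coordinate expression of a function in the preferred chart at `x`. -/
def localRepFun (f : Fun E M) (x : M) : E → ℝ := fun z => f ((extChartAt 𝓘(ℝ, E) x).symm z)

theorem localRep_add (s t : Sec E F V) (x : M) :
    localRep (s + t) x = localRep s x + localRep t x := by
  funext z; exact map_add _ _ _

theorem localRep_smul (c : ℝ) (s : Sec E F V) (x : M) :
    localRep (c • s) x = c • localRep s x := by
  funext z; exact map_smul _ _ _

theorem contDiffAt_symm_comp {G : Type*} [NormedAddCommGroup G] [NormedSpace ℝ G]
    [IsManifold 𝓘(ℝ, E) ∞ M] {f : M → G} {x : M}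
    (hf : ContMDiffAt 𝓘(ℝ, E) 𝓘(ℝ, G) ∞ f x) :
    ContDiffAt ℝ ∞ (fun z => f ((extChartAt 𝓘(ℝ, E) x).symm z)) (extChartAt 𝓘(ℝ, E) x x) := by
  have h := (contMDiffAt_iff.1 hf).2
  rw [← contDiffWithinAt_univ]
  simpa [Function.comp_def, chartAt_self_eq] using h

theorem contDiffAt_localRep [IsManifold 𝓘(ℝ, E) ∞ M] (s : Sec E F V) (x : M) :
    ContDiffAt ℝ ∞ (localRep s x) (extChartAt 𝓘(ℝ, E) x x) := by
  have h1 := (contMDiffAt_section (IB := 𝓘(ℝ, E)) (n := ∞) x).1 (s.contMDiff x)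
  have h2 : ContMDiffAt 𝓘(ℝ, E) 𝓘(ℝ, F) ∞
      (fun y => (trivializationAt F V x).continuousLinearMapAt ℝ y (s y)) x := by
    refine h1.congr_of_eventuallyEq ?_
    filter_upwards [(trivializationAt F V x).open_baseSet.mem_nhds
      (mem_baseSet_trivializationAt F V x)] with y hy
    exact Trivialization.continuousLinearMapAt_apply_of_mem ℝ _ hy _
  exact contDiffAt_symm_comp h2

theorem contDiffAt_localRepFun [IsManifold 𝓘(ℝ, E) ∞ M] (f : Fun E M) (x : M) :
    ContDiffAt ℝ ∞ (localRepFun f x) (extChartAt 𝓘(ℝ, E) x x) :=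
  contDiffAt_symm_comp (f.contMDiff x)

/-- The function `f` vanishes at `x` together with all its partial derivatives of order at
most `r`, that is, `j^r_x f = 0`. -/
def FunVanishes (r : ℕ) (x : M) (f : Fun E M) : Prop :=
  ∀ j ≤ r, iteratedFDeriv ℝ j (localRepFun f x) (extChartAt 𝓘(ℝ, E) x x) = 0

variable (E F V)

/-- The space of sections vanishing at `x` together with all their partial derivatives of order
at most `m`. -/
def vanishing [IsManifold 𝓘(ℝ, E) ∞ M] (m : ℕ) (x : M) : Submodule ℝ (Sec E F V) where
  carrier := {s | ∀ j ≤ m, iteratedFDeriv ℝ j (localRep s x) (extChartAt 𝓘(ℝ, E) x x) = 0}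
  zero_mem' := by
    intro j _
    have h : localRep (0 : Sec E F V) x = 0 := by funext z; exact map_zero _
    rw [h]; simp
  add_mem' := by
    intro s t hs ht j hj
    rw [localRep_add, iteratedFDeriv_add_apply
      ((contDiffAt_localRep s x).of_le (by exact_mod_cast le_top))
      ((contDiffAt_localRep t x).of_le (by exact_mod_cast le_top)), hs j hj, ht j hj, add_zero]
  smul_mem' := by
    intro c s hs j hj
    rw [localRep_smul, iteratedFDeriv_const_smul_apply
      ((contDiffAt_localRep s x).of_le (by exact_mod_cast le_top)), hs j hj, smul_zero]

theorem vanishing_anti [IsManifold 𝓘(ℝ, E) ∞ M] {i m : ℕ} (h : i ≤ m) (x : M) :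
    vanishing E F V m x ≤ vanishing E F V i x :=
  fun _ hs j hj => hs j (hj.trans h)

variable [IsManifold 𝓘(ℝ, E) ∞ M]

/-- The fibre `J^m_x` at `x` of the bundle of `m`-jets of sections. (On a Hausdorff manifold the
`m`-jet at `x` of a local section is always the `m`-jet at `x` of a global one.) -/
abbrev Jet (m : ℕ) (x : M) := Sec E F V ⧸ vanishing E F V m x

variable {E F V}

/-- The `m`-jet `j^m_x s` of the section `s` at the point `x`. -/
def jet (m : ℕ) (x : M) : Sec E F V →ₗ[ℝ] Jet E F V m x := (vanishing E F V m x).mkQ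

/-- The projection `π_{m,i} : J^m_x → J^i_x` for `i ≤ m`; it sends `j^m_x s` to `j^i_x s`. -/
def jetProj {i m : ℕ} (h : i ≤ m) (x : M) : Jet E F V m x →ₗ[ℝ] Jet E F V i x :=
  Submodule.factor (vanishing_anti E F V h x)

theorem jetProj_jet {i m : ℕ} (h : i ≤ m) (x : M) (s : Sec E F V) :
    jetProj h x (jet m x s) = jet i x s := rfl

variable (E F V)

/-- Scalar linear differential operators of order at most `k` on `V`, with smooth coefficients:
the linear maps `P` from smooth sections to smooth functions such that the value of `P s` at `y`
depends only on the `k`-jet of `s` at `y`. They are the same as the smooth sections of the dual of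
the bundle of `k`-jets. -/
structure DiffOp (k : ℕ) where
  toLin : Sec E F V →ₗ[ℝ] Fun E M
  order_le : ∀ (y : M) (s : Sec E F V), s ∈ vanishing E F V k y → toLin s y = 0

variable {E F V}

/-- The linear form on `J^k_y` that sends `j^k_y s` to `(P s)(y)`. -/
def DiffOp.at {k : ℕ} (P : DiffOp E F V k) (y : M) : Jet E F V k y →ₗ[ℝ] ℝ :=
  (vanishing E F V k y).liftQ
    { toFun := fun s => P.toLin s y
      map_add' := fun s t => by rw [map_add]; rfl
      map_smul' := fun c s => by rw [map_smul]; rfl }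
    (fun s hs => P.order_le y s hs)

variable (E F V)

/-- A (regular) linear differential equation of order `k` on sections of `V`: a smooth vector
subbundle `E_k` of the bundle of `k`-jets, i.e. a family of linear subspaces `E_k(x) ⊆ J^k_x`
which locally is the common zero set of finitely many smooth sections of the dual of the bundle of
`k`-jets that are linearly independent at every point. -/
structure LinEq (k : ℕ) where
  fiber : ∀ x : M, Submodule ℝ (Jet E F V k x)
  isSubbundle : ∀ x₀ : M, ∃ U ∈ 𝓝 x₀, ∃ (m : ℕ) (P : Fin m → DiffOp E F V k), ∀ y ∈ U,
    LinearIndependent ℝ (fun a => (P a).at y) ∧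
      ∀ θ : Jet E F V k y, θ ∈ fiber y ↔ ∀ a, (P a).at y θ = 0

variable {E F V}

namespace LinEq

variable {k : ℕ} (Q : LinEq E F V k)

/-- The space `Sol(E)` of global smooth solutions. -/
def Sol : Submodule ℝ (Sec E F V) where
  carrier := {s | ∀ x, jet k x s ∈ Q.fiber x}
  zero_mem' := fun x => by rw [map_zero]; exact zero_mem _
  add_mem' := fun hs ht x => by rw [map_add]; exact add_mem (hs x) (ht x)
  smul_mem' := fun c s hs x => by rw [map_smul]; exact Submodule.smul_mem _ c (hs x)

/-- `P = 0` is one of the scalar equations of the system: `P` vanishes on `E_k`. -/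
def IsEquation (P : DiffOp E F V k) : Prop := ∀ y, ∀ θ ∈ Q.fiber y, P.at y θ = 0

/-- The sections `s` such that at the point `x` all equations `P s = 0` of the system hold together
with their derivatives up to order `m - k` (no condition if `m < k`). -/
def prolSec (m : ℕ) (x : M) : Submodule ℝ (Sec E F V) where
  carrier := {s | ∀ P : DiffOp E F V k, Q.IsEquation P → ∀ r : ℕ, k + r ≤ m →
    FunVanishes r x (P.toLin s)}
  zero_mem' := by
    intro P _ r _ j _
    have h : localRepFun (P.toLin 0) x = 0 := by rw [map_zero]; rfl
    rw [h]; simp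
  add_mem' := by
    intro s t hs ht P hP r hr j hj
    have h : localRepFun (P.toLin (s + t)) x
        = localRepFun (P.toLin s) x + localRepFun (P.toLin t) x := by rw [map_add]; rfl
    rw [h, iteratedFDeriv_add_apply
      ((contDiffAt_localRepFun _ x).of_le (by exact_mod_cast le_top))
      ((contDiffAt_localRepFun _ x).of_le (by exact_mod_cast le_top)),
      hs P hP r hr j hj, ht P hP r hr j hj, add_zero]
  smul_mem' := by
    intro c s hs P hP r hr j hj
    have h : localRepFun (P.toLin (c • s)) x = c • localRepFun (P.toLin s) x := by
      rw [map_smul]; rfl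
    rw [h, iteratedFDeriv_const_smul_apply
      ((contDiffAt_localRepFun _ x).of_le (by exact_mod_cast le_top)),
      hs P hP r hr j hj, smul_zero]

/-- The fibre at `x` of `E_m`: for `m ≥ k` this is the prolongation `E_k^{(m-k)}`, the set of
`m`-jets at `x` that satisfy all equations of the system differentiated up to order `m - k`;
for `m < k` it is the whole of `J^m_x`. -/
def prol (m : ℕ) (x : M) : Submodule ℝ (Jet E F V m x) := (Q.prolSec m x).map (jet m x)

/-- The fibre at `x` of the prolongation-projection `Ē_i = ⋂_m π_{m,i}(E_m)`. -/
def bar (i : ℕ) (x : M) : Submodule ℝ (Jet E F V i x) :=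
  ⨅ (m : ℕ) (h : i ≤ m), (Q.prol m x).map (jetProj h x)

/-- The symbol `ḡ_i(x)`: the kernel of the projection `π_{i,i-1} : Ē_i → Ē_{i-1}` over `x`
(for `i = 0` the projection is the one of `Ē_0` onto `M`, so `ḡ_0 = Ē_0`). -/
def barSymbol : (i : ℕ) → (x : M) → Submodule ℝ (Jet E F V i x)
  | 0, x => Q.bar 0 x
  | i + 1, x => Q.bar (i + 1) x ⊓ LinearMap.ker (jetProj (Nat.le_succ i) x)

/-- The projection `π_{i+1,i} : E_{i+1} → E_i` is injective (over every point of `M`). -/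
def ProjInjective (i : ℕ) : Prop :=
  ∀ x : M, Set.InjOn (jetProj (E := E) (F := F) (V := V) (Nat.le_succ i) x) (Q.prol (i + 1) x)

end LinEq

end

end LinearPDE

end

/-!
The proof works in the preferred chart at a point `x`, where a scalar operator `P` of order at most
`k` has the form `P f (z) = ∑ A i z (D^i f (z))` with smooth coefficients
(`DiffOp.exists_coefficients`). The coefficients are read off by applying `P` to Taylor polynomials;
this uses that jets can be tested in any chart (`mem_vanishing_of_vanishesToOrder`), that functions
in a chart extend to global sections (`exists_sectionExtension`), and that iterated derivatives of
smooth functions are symmetric (`iteratedFDeriv_comp_perm_of_contDiffAt`).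

*Injectivity of the higher projections.* The symbol of a prolongation is the prolongation of the
symbol: if the section `s` satisfies the equations at `x` to order `i + 2` and its `i + 1`-jet
vanishes, then a coordinate derivative `∂s` satisfies them to order `i + 1` and its `i`-jet
vanishes, because `P (∂s) = ∂ (P s) - (∂P) s`. So if the kernel of `E_{i+1} → E_i` is zero, then
so is that of `E_{i+2} → E_{i+1}`, pointwise on `M` (`LinEq.ProjInjective.succ`).

*Unique continuation.* Injectivity of `E_{l+1} → E_l` at `x` implies that near `x` the derivatives
of order `l + 1` of a solution are bounded by a constant times those of lower order
(`LinEq.exists_norm_iteratedFDeriv_le`). Otherwise there are points tending to `x` at which the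
jets of the solution, normalized by the derivative of order `l + 1`, converge to a nonzero
homogeneous jet; all equations pass to the limit, so that this jet lies in the kernel. With this
bound Grönwall's inequality along segments shows that a solution whose `l`-jet vanishes at a
point vanishes nearby (`eqOn_zero_of_norm_iteratedFDeriv_le`). Hence the set of points near which a
solution vanishes is open and closed (`LinEq.eq_zero_of_jet_eq_zero`).

*Dimension.* Filter the solutions by their order of vanishing at `x`. The jets of solutions lie in
the spaces `Ē_i(x)`, so the graded pieces embed into `ḡ_i(x)` (`LinEq.rank_sol_le`), and the
filtration reaches zero at step `l` by unique continuation.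
-/

namespace LinearPDE

/-! ### Vanishing to finite order and symmetry of iterated derivatives -/

section Calculus

variable {E : Type*} [NormedAddCommGroup E] [NormedSpace ℝ E]
  {F : Type*} [NormedAddCommGroup F] [NormedSpace ℝ F]
  {G : Type*} [NormedAddCommGroup G] [NormedSpace ℝ G]

/-- The derivatives of `f` of order at most `r` all vanish at `a`. -/
def VanishesToOrder (r : ℕ) (f : E → F) (a : E) : Prop :=
  ∀ j ≤ r, iteratedFDeriv ℝ j f a = 0

theorem VanishesToOrder.mono {r r' : ℕ} {f : E → F} {a : E} (h : VanishesToOrder r' f a)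
    (hr : r ≤ r') : VanishesToOrder r f a :=
  fun j hj => h j (hj.trans hr)

theorem VanishesToOrder.congr {r : ℕ} {f g : E → F} {a : E} (h : VanishesToOrder r f a)
    (hfg : f =ᶠ[𝓝 a] g) : VanishesToOrder r g a :=
  fun j hj => by rw [← (hfg.iteratedFDeriv ℝ j).eq_of_nhds, h j hj]

theorem iteratedFDeriv_zero_eq_zero_iff {f : E → F} {a : E} :
    iteratedFDeriv ℝ 0 f a = 0 ↔ f a = 0 := by
  rw [← norm_eq_zero, norm_iteratedFDeriv_zero, norm_eq_zero]

theorem VanishesToOrder.apply_eq_zero {r : ℕ} {f : E → F} {a : E} (h : VanishesToOrder r f a) :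
    f a = 0 :=
  iteratedFDeriv_zero_eq_zero_iff.1 (h 0 (Nat.zero_le _))

theorem vanishesToOrder_zero_iff {f : E → F} {a : E} : VanishesToOrder 0 f a ↔ f a = 0 := by
  refine ⟨fun h => h.apply_eq_zero, fun h j hj => ?_⟩
  obtain rfl : j = 0 := by omega
  exact iteratedFDeriv_zero_eq_zero_iff.2 h

theorem vanishesToOrder_succ_iff {r : ℕ} {f : E → F} {a : E} :
    VanishesToOrder (r + 1) f a ↔ f a = 0 ∧ VanishesToOrder r (fderiv ℝ f) a := by
  have key : ∀ j, iteratedFDeriv ℝ j (fderiv ℝ f) a = 0 ↔ iteratedFDeriv ℝ (j + 1) f a = 0 := by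
    intro j
    rw [← norm_eq_zero, norm_iteratedFDeriv_fderiv, norm_eq_zero]
  refine ⟨fun h => ⟨h.apply_eq_zero, fun j hj => (key j).2 (h _ (by omega))⟩, fun h j hj => ?_⟩
  cases j with
  | zero => exact iteratedFDeriv_zero_eq_zero_iff.2 h.1
  | succ j => exact (key j).1 (h.2 j (by omega))

theorem contDiffAt_fderiv {f : E → F} {a : E} (hf : ContDiffAt ℝ ∞ f a) :
    ContDiffAt ℝ ∞ (fderiv ℝ f) a :=
  hf.fderiv_right (by simp)

theorem contDiffAt_fderiv_apply {f : E → F} {a : E} (hf : ContDiffAt ℝ ∞ f a) (e : E) :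
    ContDiffAt ℝ ∞ (fun z => fderiv ℝ f z e) a :=
  (contDiffAt_fderiv hf).clm_apply contDiffAt_const

theorem contDiffAt_iteratedFDeriv {f : E → F} {a : E} (hf : ContDiffAt ℝ ∞ f a) (j : ℕ) :
    ContDiffAt ℝ ∞ (iteratedFDeriv ℝ j f) a :=
  hf.iteratedFDeriv_right (by exact_mod_cast le_top)

theorem eventually_differentiableAt {f : E → F} {a : E} (hf : ContDiffAt ℝ ∞ f a) :
    ∀ᶠ z in 𝓝 a, DifferentiableAt ℝ f z := by
  have h1 : ContDiffAt ℝ 1 f a := hf.of_le (by exact_mod_cast le_top)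
  filter_upwards [h1.eventually (by simp)] with z hz
  exact hz.differentiableAt (by simp)

/-- Vanishing to order `r + 1` in terms of directional derivatives: the target space does not
change, so that inductions on `r` stay in the same space. -/
theorem vanishesToOrder_succ_iff_forall_apply {r : ℕ} {f : E → F} {a : E}
    (hf : ContDiffAt ℝ ∞ f a) :
    VanishesToOrder (r + 1) f a ↔
      f a = 0 ∧ ∀ e, VanishesToOrder r (fun z => fderiv ℝ f z e) a := by
  have key : ∀ j e, iteratedFDeriv ℝ j (fun z => fderiv ℝ f z e) a =
      (ContinuousLinearMap.apply ℝ F e).compContinuousMultilinearMap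
        (iteratedFDeriv ℝ j (fderiv ℝ f) a) := fun j e =>
    (ContinuousLinearMap.apply ℝ F e).iteratedFDeriv_comp_left (contDiffAt_fderiv hf)
      (i := j) (by exact_mod_cast le_top)
  rw [vanishesToOrder_succ_iff]
  refine and_congr_right fun _ => ⟨fun h e j hj => ?_, fun h j hj => ?_⟩
  · rw [key, h j hj]; ext; simp
  · ext v e
    have := congrArg (fun φ => φ v) ((key j e).symm.trans (h e j hj))
    simpa using this

theorem vanishesToOrder_zero_fun (r : ℕ) (a : E) : VanishesToOrder r (fun _ : E => (0 : F)) a := by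
  intro j _
  exact congrFun (iteratedFDeriv_fun_zero (𝕜 := ℝ)) a

theorem VanishesToOrder.add {r : ℕ} {f g : E → F} {a : E} (hf : ContDiffAt ℝ ∞ f a)
    (hg : ContDiffAt ℝ ∞ g a) (h : VanishesToOrder r f a) (h' : VanishesToOrder r g a) :
    VanishesToOrder r (fun z => f z + g z) a := by
  intro j hj
  have := iteratedFDeriv_add_apply (i := j) (hf.of_le (by exact_mod_cast le_top))
    (hg.of_le (by exact_mod_cast le_top))
  exact this.trans (by rw [h j hj, h' j hj, add_zero])

theorem VanishesToOrder.sub {r : ℕ} {f g : E → F} {a : E} (hf : ContDiffAt ℝ ∞ f a)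
    (hg : ContDiffAt ℝ ∞ g a) (h : VanishesToOrder r f a) (h' : VanishesToOrder r g a) :
    VanishesToOrder r (fun z => f z - g z) a := by
  intro j hj
  have := iteratedFDeriv_sub_apply (i := j) (hf.of_le (by exact_mod_cast le_top))
    (hg.of_le (by exact_mod_cast le_top))
  exact this.trans (by rw [h j hj, h' j hj, sub_zero])

theorem VanishesToOrder.sum {ι : Type*} (s : Finset ι) {r : ℕ} {f : ι → E → F} {a : E}
    (hf : ∀ i ∈ s, ContDiffAt ℝ ∞ (f i) a) (h : ∀ i ∈ s, VanishesToOrder r (f i) a) :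
    VanishesToOrder r (fun z => ∑ i ∈ s, f i z) a := by
  intro j hj
  have := iteratedFDeriv_fun_sum_apply (𝕜 := ℝ) (n := j) (x := a) (f := f) (u := s)
    (fun i hi => (hf i hi).of_le (by exact_mod_cast le_top))
  exact this.trans (Finset.sum_eq_zero fun i hi => h i hi j hj)

/-- Leibniz rule: multiplying by a smooth operator-valued function preserves vanishing. -/
theorem VanishesToOrder.clm_apply {r : ℕ} {A : E → F →L[ℝ] G} {f : E → F} {a : E}
    (hA : ContDiffAt ℝ ∞ A a) (hf : ContDiffAt ℝ ∞ f a) (h : VanishesToOrder r f a) :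
    VanishesToOrder r (fun z => A z (f z)) a := by
  induction r generalizing A f with
  | zero => rw [vanishesToOrder_zero_iff, h.apply_eq_zero, map_zero]
  | succ r ih =>
    rw [vanishesToOrder_succ_iff_forall_apply (hA.clm_apply hf)]
    refine ⟨by rw [h.apply_eq_zero, map_zero], fun e => ?_⟩
    have h' := (vanishesToOrder_succ_iff_forall_apply hf).1 h
    have hA' := contDiffAt_fderiv_apply hA e
    have hf' := contDiffAt_fderiv_apply hf e
    refine VanishesToOrder.congr ((ih hA hf' (h'.2 e)).add (hA.clm_apply hf') (hA'.clm_apply hf)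
      (ih hA' hf (h.mono (Nat.le_succ r)))) ?_
    filter_upwards [eventually_differentiableAt hA, eventually_differentiableAt hf] with z h1 h2
    rw [fderiv_clm_apply h1 h2]
    simp

theorem VanishesToOrder.comp {r : ℕ} {f : F → G} {ψ : E → F} {a : E}
    (hf : ContDiffAt ℝ ∞ f (ψ a)) (hψ : ContDiffAt ℝ ∞ ψ a) (h : VanishesToOrder r f (ψ a)) :
    VanishesToOrder r (fun z => f (ψ z)) a := by
  intro j hj
  have := iteratedFDeriv_comp hf hψ (i := j) (by exact_mod_cast le_top)
  refine this.trans (Finset.sum_eq_zero fun c _ => ?_)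
  ext v
  have h0 : ftaylorSeries ℝ f (ψ a) c.length = 0 := h _ (c.length_le.trans hj)
  rw [FormalMultilinearSeries.compAlongOrderedFinpartition_apply, h0]
  rfl

theorem differentiableAt_iteratedFDeriv {n : ℕ} {f : E → F} {a : E}
    (hf : ContDiffAt ℝ (n + 1 : ℕ) f a) : DifferentiableAt ℝ (iteratedFDeriv ℝ n f) a :=
  (hf.iteratedFDeriv_right (m := 1) (by norm_cast; omega)).differentiableAt (by simp)

theorem iteratedFDeriv_succ_apply_eq_fderiv {n : ℕ} {f : E → F} {a : E}
    (hf : ContDiffAt ℝ (n + 1 : ℕ) f a) (v : Fin (n + 1) → E) :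
    iteratedFDeriv ℝ (n + 1) f a v =
      fderiv ℝ (fun z => iteratedFDeriv ℝ n f z (Fin.tail v)) a (v 0) := by
  have := ((ContinuousMultilinearMap.apply ℝ (fun _ : Fin n => E) F
    (Fin.tail v)).hasFDerivAt.comp a (differentiableAt_iteratedFDeriv hf).hasFDerivAt).fderiv
  rw [iteratedFDeriv_succ_apply_left, show (fun z => iteratedFDeriv ℝ n f z (Fin.tail v)) =
    ContinuousMultilinearMap.apply ℝ (fun _ : Fin n => E) F (Fin.tail v) ∘
      iteratedFDeriv ℝ n f from rfl, this]
  rfl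

theorem contDiffAt_iteratedFDeriv_apply {f : E → F} {a : E} (hf : ContDiffAt ℝ ∞ f a) {j : ℕ}
    (v : Fin j → E) : ContDiffAt ℝ ∞ (fun z => iteratedFDeriv ℝ j f z v) a :=
  (ContinuousMultilinearMap.apply ℝ (fun _ : Fin j => E) F v).contDiff.contDiffAt.comp a
    (contDiffAt_iteratedFDeriv hf j)

theorem VanishesToOrder.iteratedFDeriv {j m : ℕ} {f : E → F} {a : E} (hf : ContDiffAt ℝ ∞ f a)
    (h : VanishesToOrder (m + j) f a) : VanishesToOrder m (iteratedFDeriv ℝ j f) a := by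
  have key : ∀ v : Fin j → E, VanishesToOrder m (fun z => _root_.iteratedFDeriv ℝ j f z v) a := by
    intro v
    induction j generalizing m with
    | zero => simpa using h
    | succ j ih =>
      have h1 := (vanishesToOrder_succ_iff_forall_apply (contDiffAt_iteratedFDeriv_apply hf _)).1
        (ih (m := m + 1) (h.mono (by omega)) (Fin.tail v))
      refine (h1.2 (v 0)).congr ?_
      have hev : ∀ᶠ z in 𝓝 a, ContDiffAt ℝ (j + 1 : ℕ) f z :=
        (hf.of_le (by exact_mod_cast le_top)).eventually (by simp)
      filter_upwards [hev] with z hz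
      exact (iteratedFDeriv_succ_apply_eq_fderiv hz v).symm
  intro i hi
  ext w v
  have h1 := (ContinuousMultilinearMap.apply ℝ (fun _ : Fin j => E) F v).iteratedFDeriv_comp_left
    (contDiffAt_iteratedFDeriv hf j) (i := i) (by exact_mod_cast le_top)
  exact congrArg (fun φ => φ w) (h1.symm.trans (key v i hi))

/-- The iterated derivatives of a smooth function are symmetric. The case of a swap of the first
two arguments is the symmetry of the second derivative; adjacent swaps generate the group of
permutations. -/
theorem iteratedFDeriv_comp_perm_of_contDiffAt {f : E → F} {a : E} {n : ℕ}
    (hf : ContDiffAt ℝ n f a) (v : Fin n → E) (σ : Equiv.Perm (Fin n)) :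
    iteratedFDeriv ℝ n f a (v ∘ σ) = iteratedFDeriv ℝ n f a v := by
  induction n generalizing f a with
  | zero => congr 1; exact Subsingleton.elim _ _
  | succ n ih =>
    have hσ : σ ∈ Submonoid.closure
        (Set.range fun i : Fin n => Equiv.swap i.castSucc i.succ) := by
      rw [Equiv.Perm.mclosure_swap_castSucc_succ]; trivial
    induction hσ using Submonoid.closure_induction generalizing v with
    | one => rfl
    | mul x y _ _ hx hy =>
      rw [Equiv.Perm.coe_mul, ← Function.comp_assoc, hy, hx]
    | mem x hx =>
      obtain ⟨i, rfl⟩ := hx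
      cases n with
      | zero => exact i.elim0
      | succ n =>
      have hev : ∀ᶠ z in 𝓝 a, ContDiffAt ℝ (n + 1 : ℕ) f z :=
        (hf.of_le (by norm_cast; omega)).eventually (by simp)
      have hφ : ∀ u : Fin n → E, ContDiffAt ℝ 2 (fun z => iteratedFDeriv ℝ n f z u) a := fun u =>
        (ContinuousMultilinearMap.apply ℝ (fun _ : Fin n => E) F u).contDiff.contDiffAt.comp a
          (hf.iteratedFDeriv_right (by norm_cast; omega))
      induction i using Fin.cases with
      | zero =>
        have key : ∀ u : Fin (n + 2) → E, iteratedFDeriv ℝ (n + 2) f a u =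
            fderiv ℝ (fderiv ℝ fun z => iteratedFDeriv ℝ n f z fun j => u j.succ.succ) a
              (u 0) (u 1) := by
          intro u
          have hd : DifferentiableAt ℝ
              (fderiv ℝ fun z => iteratedFDeriv ℝ n f z fun j => u j.succ.succ) a :=
            ((hφ _).fderiv_right (m := 1) (by norm_num)).differentiableAt (by simp)
          rw [iteratedFDeriv_succ_apply_eq_fderiv hf]
          have h3 : (fun z => iteratedFDeriv ℝ (n + 1) f z (Fin.tail u)) =ᶠ[𝓝 a]
              fun z => fderiv ℝ (fun y => iteratedFDeriv ℝ n f y fun j => u j.succ.succ) z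
                (u 1) := by
            filter_upwards [hev] with z hz
            exact iteratedFDeriv_succ_apply_eq_fderiv hz _
          rw [h3.fderiv_eq, fderiv_clm_apply hd (differentiableAt_const _)]
          simp
        have h4 : (fun j : Fin n => (v ∘ Equiv.swap (Fin.castSucc 0) (Fin.succ 0)) j.succ.succ) =
            fun j => v j.succ.succ := by
          funext j
          simp only [Function.comp_apply]
          rw [Equiv.swap_apply_of_ne_of_ne]
          · exact Fin.succ_ne_zero _
          · simp [Fin.ext_iff]
        rw [key, key, h4, ((hφ _).isSymmSndFDerivAt (by simp)).eq]
        simp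
      | succ i =>
        have h0 : (v ∘ Equiv.swap i.succ.castSucc i.succ.succ) 0 = v 0 := by
          simp only [Function.comp_apply]
          rw [Equiv.swap_apply_of_ne_of_ne]
          · simp [Fin.ext_iff]
          · simp [Fin.ext_iff]
        have ht : Fin.tail (v ∘ Equiv.swap i.succ.castSucc i.succ.succ) =
            Fin.tail v ∘ Equiv.swap i.castSucc i.succ := by
          funext j
          simp only [Fin.tail, Function.comp_apply]
          rw [← Fin.succ_castSucc, ← (Fin.succ_injective _).map_swap]
        rw [iteratedFDeriv_succ_apply_eq_fderiv hf, iteratedFDeriv_succ_apply_eq_fderiv hf, h0, ht]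
        congr 1
        refine Filter.EventuallyEq.fderiv_eq ?_
        filter_upwards [hev] with z hz
        exact ih hz _ _

/-- The homogeneous polynomial map `w ↦ p (w - z, …, w - z)`, for `p` not necessarily symmetric. -/
def polyAt {n : ℕ} (p : E [×n]→L[ℝ] F) (z w : E) : F := p fun _ => w - z

theorem contDiff_polyAt {n : ℕ} (p : E [×n]→L[ℝ] F) (z : E) : ContDiff ℝ ∞ (polyAt p z) :=
  p.contDiff.comp (contDiff_pi.2 fun _ => contDiff_id.sub contDiff_const)

theorem hasFPowerSeriesOnBall_polyAt {n : ℕ} (p : E [×n]→L[ℝ] F) (z : E) :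
    HasFPowerSeriesOnBall (polyAt p z)
      (fun j => if h : n = j then h ▸ p else 0) z ⊤ where
  r_le := by
    rw [top_le_iff]
    refine FormalMultilinearSeries.radius_eq_top_of_forall_image_add_eq_zero _ (n + 1) fun m => ?_
    rw [dif_neg (by omega)]
  r_pos := ENNReal.zero_lt_top
  hasSum := by
    intro y _
    have : polyAt p z (z + y) = (fun j => (if h : n = j then h ▸ p else 0 : E [×j]→L[ℝ] F)
        fun _ => y) n := by
      simp [polyAt]
    rw [this]
    refine hasSum_single n fun j hj => ?_
    simp [Ne.symm hj]

theorem iteratedFDeriv_polyAt_self [CompleteSpace F] {n : ℕ} (p : E [×n]→L[ℝ] F) (z : E)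
    (v : Fin n → E) :
    iteratedFDeriv ℝ n (polyAt p z) z v = ∑ σ : Equiv.Perm (Fin n), p (v ∘ σ) := by
  rw [(hasFPowerSeriesOnBall_polyAt p z).iteratedFDeriv_eq_sum_of_completeSpace]
  simp [Function.comp_def]

theorem iteratedFDeriv_polyAt_of_ne [CompleteSpace F] {n j : ℕ} (p : E [×n]→L[ℝ] F) (z : E)
    (h : n ≠ j) : iteratedFDeriv ℝ j (polyAt p z) z = 0 := by
  ext v
  rw [(hasFPowerSeriesOnBall_polyAt p z).iteratedFDeriv_eq_sum_of_completeSpace]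
  simp [h]

theorem iteratedFDeriv_polyAt_of_symm [CompleteSpace F] {n : ℕ} (p : E [×n]→L[ℝ] F) (z : E)
    (hp : ∀ v (σ : Equiv.Perm (Fin n)), p (v ∘ σ) = p v) :
    iteratedFDeriv ℝ n (polyAt p z) z = (n.factorial : ℝ) • p := by
  ext v
  rw [iteratedFDeriv_polyAt_self]
  simp [hp, Fintype.card_perm, ← Nat.cast_smul_eq_nsmul ℝ]

end Calculus

/-! ### Linear differential operators in coordinates -/

section Operators

variable {E : Type*} [NormedAddCommGroup E] [NormedSpace ℝ E]
  {F : Type*} [NormedAddCommGroup F] [NormedSpace ℝ F]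

instance finiteDimensional_continuousMultilinearMap [FiniteDimensional ℝ E]
    [FiniteDimensional ℝ F] (n : ℕ) : FiniteDimensional ℝ (E [×n]→L[ℝ] F) :=
  Module.Finite.of_injective
    (ContinuousMultilinearMap.toMultilinearMapLinear :
      (E [×n]→L[ℝ] F) →ₗ[ℝ] MultilinearMap ℝ (fun _ : Fin n => E) F)
    ContinuousMultilinearMap.toMultilinearMap_injective

/-- The value at `z` of the scalar linear differential operator of order at most `n` with
coefficients `A i`, applied to `f`: the sum of the terms `A i z (D^i f (z))` for `i ≤ n`. The coefficients `A i` with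
`i > n` play no role. -/
noncomputable def jetEval (A : (i : ℕ) → E → (E [×i]→L[ℝ] F) →L[ℝ] ℝ) (n : ℕ) (f : E → F) (z : E) : ℝ :=
  ∑ i ∈ Finset.range (n + 1), A i z (iteratedFDeriv ℝ i f z)

theorem contDiffAt_jetEval {A : (i : ℕ) → E → (E [×i]→L[ℝ] F) →L[ℝ] ℝ} {n : ℕ} {f : E → F}
    {a : E} (hA : ∀ i, ContDiffAt ℝ ∞ (A i) a) (hf : ContDiffAt ℝ ∞ f a) :
    ContDiffAt ℝ ∞ (jetEval A n f) a :=
  ContDiffAt.sum fun i _ => (hA i).clm_apply (contDiffAt_iteratedFDeriv hf i)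

theorem jetEval_congr {A : (i : ℕ) → E → (E [×i]→L[ℝ] F) →L[ℝ] ℝ} {n : ℕ} {f g : E → F}
    {a : E} (h : f =ᶠ[𝓝 a] g) : jetEval A n f =ᶠ[𝓝 a] jetEval A n g := by
  filter_upwards [h.eventuallyEq_nhds] with z hz
  exact Finset.sum_congr rfl fun i _ => by rw [(hz.iteratedFDeriv ℝ i).eq_of_nhds]

theorem VanishesToOrder.jetEval {A : (i : ℕ) → E → (E [×i]→L[ℝ] F) →L[ℝ] ℝ} {n r : ℕ}
    {f : E → F} {a : E} (hA : ∀ i, ContDiffAt ℝ ∞ (A i) a) (hf : ContDiffAt ℝ ∞ f a)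
    (h : VanishesToOrder (r + n) f a) : VanishesToOrder r (jetEval A n f) a := by
  refine VanishesToOrder.sum _ (fun i _ => (hA i).clm_apply (contDiffAt_iteratedFDeriv hf i))
    fun i hi => ?_
  have := Finset.mem_range.1 hi
  exact VanishesToOrder.clm_apply (hA i) (contDiffAt_iteratedFDeriv hf i)
    (VanishesToOrder.iteratedFDeriv hf (h.mono (by omega)))

/-- Directional derivatives commute with iterated derivatives. -/
theorem iteratedFDeriv_fderiv_apply {f : E → F} {a : E} {j : ℕ}
    (hf : ContDiffAt ℝ (j + 1 : ℕ) f a) (e : E) : iteratedFDeriv ℝ j (fun z => fderiv ℝ f z e) a =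
      fderiv ℝ (iteratedFDeriv ℝ j f) a e := by
  have h1 := (ContinuousLinearMap.apply ℝ F e).iteratedFDeriv_comp_left
    (hf.fderiv_right (m := j) (by norm_cast)) (i := j) le_rfl
  refine h1.trans ?_
  ext v
  have h2 : fderiv ℝ (iteratedFDeriv ℝ j f) a e v =
      iteratedFDeriv ℝ (j + 1) f a (Fin.cons e v) := by
    rw [iteratedFDeriv_succ_apply_left]; simp
  have h3 : iteratedFDeriv ℝ j (fderiv ℝ f) a v e =
      iteratedFDeriv ℝ (j + 1) f a (Fin.snoc v e) := by
    rw [iteratedFDeriv_succ_apply_right]; simp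
  have h4 : (Fin.snoc v e : Fin (j + 1) → E) =
      (Fin.cons e v : Fin (j + 1) → E) ∘ finRotate (j + 1) := by
    rw [Fin.snoc_eq_cons_rotate]; rfl
  rw [h2, ← iteratedFDeriv_comp_perm_of_contDiffAt hf (Fin.cons e v) (finRotate (j + 1)), ← h4, ← h3]
  rfl

theorem eventually_iteratedFDeriv_fderiv_apply {f : E → F} {a : E} (hf : ContDiffAt ℝ ∞ f a)
    (j : ℕ) (e : E) : ∀ᶠ z in 𝓝 a, iteratedFDeriv ℝ j (fun z => fderiv ℝ f z e) z =
      fderiv ℝ (iteratedFDeriv ℝ j f) z e := by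
  have hev : ∀ᶠ z in 𝓝 a, ContDiffAt ℝ (j + 1 : ℕ) f z :=
    (hf.of_le (by exact_mod_cast le_top)).eventually (by simp)
  filter_upwards [hev] with z hz
  exact iteratedFDeriv_fderiv_apply hz e

/-- Leibniz rule for a differential operator: the derivative of `P f` is `(∂P) f + P (∂f)`, where
`∂P` has the differentiated coefficients and the order of `P`. -/
theorem fderiv_jetEval {A : (i : ℕ) → E → (E [×i]→L[ℝ] F) →L[ℝ] ℝ} {n : ℕ} {f : E → F}
    {a : E} (hA : ∀ i, ContDiffAt ℝ ∞ (A i) a) (hf : ContDiffAt ℝ ∞ f a) (e : E) :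
    (fun z => fderiv ℝ (jetEval A n f) z e) =ᶠ[𝓝 a] fun z =>
      jetEval (fun i y => fderiv ℝ (A i) y e) n f z +
        jetEval A n (fun y => fderiv ℝ f y e) z := by
  have h1 : ∀ᶠ z in 𝓝 a, ∀ i ∈ Finset.range (n + 1), DifferentiableAt ℝ (A i) z :=
    (Filter.eventually_all_finset _).2 fun i _ => eventually_differentiableAt (hA i)
  have h2 : ∀ᶠ z in 𝓝 a, ∀ i ∈ Finset.range (n + 1),
      DifferentiableAt ℝ (iteratedFDeriv ℝ i f) z :=
    (Filter.eventually_all_finset _).2 fun i _ =>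
      eventually_differentiableAt (contDiffAt_iteratedFDeriv hf i)
  have h3 := (Filter.eventually_all_finset (Finset.range (n + 1))).2 fun i _ =>
      eventually_iteratedFDeriv_fderiv_apply hf i e
  filter_upwards [h1, h2, h3] with z hz1 hz2 hz3
  unfold jetEval
  rw [fderiv_fun_sum fun i hi => (hz1 i hi).clm_apply (hz2 i hi), ← Finset.sum_add_distrib,
    _root_.sum_apply]
  refine Finset.sum_congr rfl fun i hi => ?_
  rw [fderiv_clm_apply (hz1 i hi) (hz2 i hi), hz3 i hi]
  simp [add_comm]

/-- Freezing the first argument of a multilinear map. -/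
noncomputable def evalFirst [FiniteDimensional ℝ E] [FiniteDimensional ℝ F] (n : ℕ) (e : E) :
    (E [×(n + 1)]→L[ℝ] F) →L[ℝ] (E [×n]→L[ℝ] F) :=
  LinearMap.toContinuousLinearMap
    { toFun := fun B => B.curryLeft e
      map_add' := fun _ _ => rfl
      map_smul' := fun _ _ => rfl }

/-- The coefficients of the derivative in direction `e` of the operator of order at most `n`
with coefficients `A`. The case distinction discards the irrelevant coefficient `A (n + 1)`. -/
noncomputable def derivCoeff [FiniteDimensional ℝ E] [FiniteDimensional ℝ F]
    (A : (i : ℕ) → E → (E [×i]→L[ℝ] F) →L[ℝ] ℝ) (n : ℕ) (e : E) :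
    (i : ℕ) → E → (E [×i]→L[ℝ] F) →L[ℝ] ℝ
  | 0, z => fderiv ℝ (A 0) z e
  | i + 1, z => (if i < n then fderiv ℝ (A (i + 1)) z e else 0) + A i z ∘L evalFirst i e

theorem contDiffAt_derivCoeff [FiniteDimensional ℝ E] [FiniteDimensional ℝ F]
    {A : (i : ℕ) → E → (E [×i]→L[ℝ] F) →L[ℝ] ℝ} {a : E} (hA : ∀ i, ContDiffAt ℝ ∞ (A i) a)
    (n : ℕ) (e : E) (i : ℕ) : ContDiffAt ℝ ∞ (derivCoeff A n e i) a := by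
  cases i with
  | zero => exact contDiffAt_fderiv_apply (hA 0) e
  | succ i =>
    refine ContDiffAt.add ?_ ((hA i).clm_comp contDiffAt_const)
    split_ifs
    · exact contDiffAt_fderiv_apply (hA (i + 1)) e
    · exact contDiffAt_const

theorem fderiv_jetEval_eq_jetEval_derivCoeff [FiniteDimensional ℝ E] [FiniteDimensional ℝ F]
    {A : (i : ℕ) → E → (E [×i]→L[ℝ] F) →L[ℝ] ℝ} {n : ℕ} {f : E → F}
    {a : E} (hA : ∀ i, ContDiffAt ℝ ∞ (A i) a) (hf : ContDiffAt ℝ ∞ f a) (e : E) :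
    (fun z => fderiv ℝ (jetEval A n f) z e) =ᶠ[𝓝 a] jetEval (derivCoeff A n e) (n + 1) f := by
  have h3 := (Filter.eventually_all_finset (Finset.range (n + 1))).2 fun i _ =>
      eventually_iteratedFDeriv_fderiv_apply hf i e
  filter_upwards [fderiv_jetEval (n := n) hA hf e, h3] with z hz hz3
  rw [hz]
  unfold jetEval
  rw [Finset.sum_range_succ' _ (n + 1)]
  simp only [derivCoeff, _root_.add_apply, Finset.sum_add_distrib]
  rw [add_right_comm]
  congr 1
  · rw [Finset.sum_range_succ' _ n, Finset.sum_range_succ _ n]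
    simp only [lt_irrefl, if_false, _root_.zero_apply, add_zero]
    congr 1
    refine Finset.sum_congr rfl fun i hi => ?_
    rw [if_pos (Finset.mem_range.1 hi)]
  · refine Finset.sum_congr rfl fun i hi => ?_
    rw [hz3 i hi]
    rfl

end Operators

/-! ### Sections in charts -/

section Charts

variable {E : Type*} [NormedAddCommGroup E] [NormedSpace ℝ E]
  {M : Type*} [TopologicalSpace M] [ChartedSpace E M]

theorem eventually_symm_mem {x : M} {u : Set M} (hu : u ∈ 𝓝 x) :
    ∀ᶠ z in 𝓝 (extChartAt 𝓘(ℝ, E) x x), (extChartAt 𝓘(ℝ, E) x).symm z ∈ u :=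
  (continuousAt_extChartAt_symm x).preimage_mem_nhds (by simpa using hu)

variable [IsManifold 𝓘(ℝ, E) ∞ M]

/-- A smooth function on the manifold is smooth in any chart around the point, not only in the
preferred chart at that point. -/
theorem contDiffAt_comp_extChartAt_symm {G : Type*} [NormedAddCommGroup G] [NormedSpace ℝ G]
    {f : M → G} {x y : M} (hy : y ∈ (extChartAt 𝓘(ℝ, E) x).source)
    (hf : ContMDiffAt 𝓘(ℝ, E) 𝓘(ℝ, G) ∞ f y) :
    ContDiffAt ℝ ∞ (fun z => f ((extChartAt 𝓘(ℝ, E) x).symm z)) (extChartAt 𝓘(ℝ, E) x y) := by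
  rw [← contMDiffAt_iff_contDiffAt]
  have hz := (extChartAt 𝓘(ℝ, E) x).map_source hy
  have h1 : ContMDiffAt 𝓘(ℝ, E) 𝓘(ℝ, E) ∞ (extChartAt 𝓘(ℝ, E) x).symm
      (extChartAt 𝓘(ℝ, E) x y) :=
    (contMDiffOn_extChartAt_symm x).contMDiffAt (extChartAt_target_mem_nhds' hz)
  refine ContMDiffAt.comp _ ?_ h1
  rwa [(extChartAt 𝓘(ℝ, E) x).left_inv hy]

variable {F : Type*} [NormedAddCommGroup F] [NormedSpace ℝ F]
  {V : M → Type*} [TopologicalSpace (TotalSpace F V)]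
  [∀ x, AddCommGroup (V x)] [∀ x, Module ℝ (V x)] [∀ x, TopologicalSpace (V x)]
  [FiberBundle F V] [VectorBundle ℝ F V]

theorem mem_vanishing_iff {m : ℕ} {x : M} {s : Sec E F V} :
    s ∈ vanishing E F V m x ↔
      VanishesToOrder m (localRep s x) (extChartAt 𝓘(ℝ, E) x x) := Iff.rfl

theorem jet_eq_zero_iff {m : ℕ} {x : M} {s : Sec E F V} :
    jet m x s = 0 ↔ s ∈ vanishing E F V m x :=
  Submodule.Quotient.mk_eq_zero _

namespace LinEq

variable {k : ℕ} {Q : LinEq E F V k}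

theorem projInjective_iff {i : ℕ} : Q.ProjInjective i ↔
    ∀ x, ∀ s ∈ Q.prolSec (i + 1) x, s ∈ vanishing E F V i x → s ∈ vanishing E F V (i + 1) x := by
  refine forall_congr' fun x => ⟨fun h s hs hv => ?_, fun h θ hθ θ' hθ' hp => ?_⟩
  · rw [← jet_eq_zero_iff]
    refine h ⟨s, hs, rfl⟩ (zero_mem _) ?_
    rw [jetProj_jet, map_zero]
    exact jet_eq_zero_iff.2 hv
  · obtain ⟨s, hs, rfl⟩ := hθ
    obtain ⟨s', hs', rfl⟩ := hθ'
    rw [jetProj_jet, jetProj_jet, ← sub_eq_zero, ← map_sub, jet_eq_zero_iff] at hp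
    rw [← sub_eq_zero, ← map_sub, jet_eq_zero_iff]
    exact h _ (sub_mem hs hs') hp

theorem IsEquation.toLin_eq_zero {P : DiffOp E F V k} (hP : Q.IsEquation P) {s : Sec E F V}
    (hs : s ∈ Q.Sol) : P.toLin s = 0 := by
  ext y
  exact hP y _ (hs y)

end LinEq

variable [ContMDiffVectorBundle ∞ F V 𝓘(ℝ, E)]

theorem contDiffAt_localRep_of_mem (s : Sec E F V) {x y : M}
    (hy : y ∈ (extChartAt 𝓘(ℝ, E) x).source) (hy' : y ∈ (trivializationAt F V x).baseSet) :
    ContDiffAt ℝ ∞ (localRep s x) (extChartAt 𝓘(ℝ, E) x y) := by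
  have h1 := ((trivializationAt F V x).contMDiffAt_section_iff (IB := 𝓘(ℝ, E)) (n := ∞) hy').1
    (s.contMDiff y)
  have h2 : ContMDiffAt 𝓘(ℝ, E) 𝓘(ℝ, F) ∞
      (fun y => (trivializationAt F V x).continuousLinearMapAt ℝ y (s y)) y := by
    refine h1.congr_of_eventuallyEq ?_
    filter_upwards [(trivializationAt F V x).open_baseSet.mem_nhds hy'] with p hp
    exact Trivialization.continuousLinearMapAt_apply_of_mem ℝ _ hp _
  exact contDiffAt_comp_extChartAt_symm hy h2

theorem eventually_contDiffAt_localRep (s : Sec E F V) (x : M) :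
    ∀ᶠ z in 𝓝 (extChartAt 𝓘(ℝ, E) x x), ContDiffAt ℝ ∞ (localRep s x) z := by
  filter_upwards [extChartAt_target_mem_nhds x,
    eventually_symm_mem (E := E) (extChartAt_source_mem_nhds (I := 𝓘(ℝ, E)) x),
    eventually_symm_mem (E := E) ((trivializationAt F V x).open_baseSet.mem_nhds
      (mem_baseSet_trivializationAt F V x))] with z h1 h2 h3
  have := contDiffAt_localRep_of_mem s h2 h3
  rwa [(extChartAt 𝓘(ℝ, E) x).right_inv h1] at this

/-- Vanishing of the jet of a section at `y` can be tested in the chart and the trivialization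
preferred at another point `x`. -/
theorem mem_vanishing_of_vanishesToOrder (s : Sec E F V) {x y : M} {k : ℕ}
    (hy : y ∈ (extChartAt 𝓘(ℝ, E) x).source) (hy' : y ∈ (trivializationAt F V x).baseSet)
    (h : VanishesToOrder k (localRep s x) (extChartAt 𝓘(ℝ, E) x y)) :
    s ∈ vanishing E F V k y := by
  have hs := contDiffAt_localRep_of_mem s hy hy'
  have hψ : ContDiffAt ℝ ∞
      (fun w => extChartAt 𝓘(ℝ, E) x ((extChartAt 𝓘(ℝ, E) y).symm w))
      (extChartAt 𝓘(ℝ, E) y y) :=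
    contDiffAt_symm_comp (contMDiffAt_extChartAt' (by simpa using hy))
  have hψy : extChartAt 𝓘(ℝ, E) x
      ((extChartAt 𝓘(ℝ, E) y).symm (extChartAt 𝓘(ℝ, E) y y)) = extChartAt 𝓘(ℝ, E) x y := by simp
  have hC : ContDiffAt ℝ ∞ (fun w => ((trivializationAt F V x).coordChangeL ℝ
      (trivializationAt F V y) ((extChartAt 𝓘(ℝ, E) y).symm w) : F →L[ℝ] F))
      (extChartAt 𝓘(ℝ, E) y y) :=
    contDiffAt_symm_comp (contMDiffAt_coordChangeL hy' (mem_baseSet_trivializationAt F V y))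
  rw [← hψy] at h hs
  refine (VanishesToOrder.clm_apply hC (ContDiffAt.comp (g := localRep s x) _ hs hψ) (VanishesToOrder.comp (f := localRep s x) hs hψ h)).congr ?_
  filter_upwards [
    eventually_symm_mem (E := E) (extChartAt_source_mem_nhds' (I := 𝓘(ℝ, E)) hy),
    eventually_symm_mem (E := E) ((trivializationAt F V x).open_baseSet.mem_nhds hy'),
    eventually_symm_mem (E := E) ((trivializationAt F V y).open_baseSet.mem_nhds
      (mem_baseSet_trivializationAt F V y))] with w h1 h2 h3
  simp only [localRep, Function.comp_apply, ContinuousLinearEquiv.coe_coe]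
  rw [(extChartAt 𝓘(ℝ, E) x).left_inv h1, Trivialization.coordChangeL_apply _ _ ⟨h2, h3⟩,
    Trivialization.continuousLinearMapAt_apply_of_mem ℝ _ h3, ← Trivialization.symmL_apply (R := ℝ) _ h2,
    Trivialization.symmL_continuousLinearMapAt _ h2]

/-- The smooth maps between two normed spaces. -/
def smoothMaps (E F : Type*) [NormedAddCommGroup E] [NormedSpace ℝ E] [NormedAddCommGroup F]
    [NormedSpace ℝ F] : Submodule ℝ (E → F) where
  carrier := {f | ContDiff ℝ ∞ f}
  zero_mem' := (contDiff_const : ContDiff ℝ ∞ fun _ : E => (0 : F))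
  add_mem' := fun {f g} (hf : ContDiff ℝ ∞ f) (hg : ContDiff ℝ ∞ g) => hf.add hg
  smul_mem' := fun c f (hf : ContDiff ℝ ∞ f) => (contDiff_const.smul hf : ContDiff ℝ ∞ (c • f))

variable [T2Space M] [FiniteDimensional ℝ E]

variable (F V) in
/-- Local sections extend to global ones: multiplication with a bump function gives a linear map
from vector valued functions in the chart at `x` to global sections, which prescribes the
coordinate expression on a neighbourhood of `x` that does not depend on the function. -/
theorem exists_sectionExtension (x : M) : ∃ L : smoothMaps E F →ₗ[ℝ] Sec E F V,
    ∀ᶠ z in 𝓝 (extChartAt 𝓘(ℝ, E) x x), ∀ g, localRep (L g) x z = (g : E → F) z := by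
  have hbase := (trivializationAt F V x).open_baseSet.mem_nhds
      (mem_baseSet_trivializationAt F V x)
  obtain ⟨χ, hχ, -⟩ := (SmoothBumpFunction.nhds_basis_support (I := 𝓘(ℝ, E)) hbase).mem_iff.1
    hbase
  have hsm : ∀ g : smoothMaps E F, ContMDiff 𝓘(ℝ, E) (𝓘(ℝ, E).prod 𝓘(ℝ, F)) ∞
      fun y => TotalSpace.mk' F y (χ y • (trivializationAt F V x).symmL ℝ y
        ((g : E → F) (extChartAt 𝓘(ℝ, E) x y))) := by
    intro g
    have hu : IsOpen ((chartAt E x).source ∩ (trivializationAt F V x).baseSet) :=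
      (chartAt E x).open_source.inter (trivializationAt F V x).open_baseSet
    refine ContMDiffOn.smul_section_of_tsupport (u := (chartAt E x).source ∩
      (trivializationAt F V x).baseSet) χ.contMDiff.contMDiffOn hu
      (Set.subset_inter χ.tsupport_subset_chartAt_source hχ) ?_
    rw [(trivializationAt F V x).contMDiffOn_section_iff hu Set.inter_subset_right]
    have h1 : ContMDiffOn 𝓘(ℝ, E) 𝓘(ℝ, F) ∞ (fun y => (g : E → F) (extChartAt 𝓘(ℝ, E) x y))
        ((chartAt E x).source ∩ (trivializationAt F V x).baseSet) :=
      (ContDiff.contMDiff (show ContDiff ℝ ∞ (g : E → F) from g.2)).comp_contMDiffOn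
        (contMDiffOn_extChartAt.mono Set.inter_subset_left)
    refine h1.congr fun y hy => ?_
    rw [← Trivialization.continuousLinearMapAt_apply_of_mem ℝ _ hy.2,
      Trivialization.continuousLinearMapAt_symmL _ hy.2]
  refine ⟨{ toFun := fun g => ⟨_, hsm g⟩, map_add' := ?_, map_smul' := ?_ }, ?_⟩
  · intro g g'
    ext y
    change χ y • (trivializationAt F V x).symmL ℝ y
      ((g : E → F) (extChartAt 𝓘(ℝ, E) x y) + (g' : E → F) (extChartAt 𝓘(ℝ, E) x y)) = _
    rw [map_add, smul_add]
    rfl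
  · intro c g
    ext y
    change χ y • (trivializationAt F V x).symmL ℝ y
      (c • (g : E → F) (extChartAt 𝓘(ℝ, E) x y)) = _
    rw [map_smul, smul_comm]
    rfl
  · filter_upwards [extChartAt_target_mem_nhds x, eventually_symm_mem (E := E) hbase,
      eventually_symm_mem (E := E) χ.eventuallyEq_one] with z h1 h2 h3 g
    have h3' : χ ((extChartAt 𝓘(ℝ, E) x).symm z) = 1 := h3
    change (trivializationAt F V x).continuousLinearMapAt ℝ _
      (χ ((extChartAt 𝓘(ℝ, E) x).symm z) • (trivializationAt F V x).symmL ℝ _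
        ((g : E → F) (extChartAt 𝓘(ℝ, E) x ((extChartAt 𝓘(ℝ, E) x).symm z)))) = _
    rw [h3', one_smul, Trivialization.continuousLinearMapAt_symmL _ h2,
      (extChartAt 𝓘(ℝ, E) x).right_inv h1]

end Charts

/-! ### Coefficients of a scalar differential operator -/

section Coefficients

variable {E : Type*} [NormedAddCommGroup E] [NormedSpace ℝ E]
  {F : Type*} [NormedAddCommGroup F] [NormedSpace ℝ F]

/-- Pointwise smoothness of a family of linear forms on a finite-dimensional space. -/
theorem contDiffAt_dual_of_apply {W : Type*} [NormedAddCommGroup W] [NormedSpace ℝ W]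
    [FiniteDimensional ℝ W] {A : E → W →L[ℝ] ℝ} {a : E}
    (h : ∀ w, ContDiffAt ℝ ∞ (fun z => A z w) a) : ContDiffAt ℝ ∞ A a := by
  have hA : A = fun z => ∑ i, A z (Module.finBasis ℝ W i) •
      LinearMap.toContinuousLinearMap ((Module.finBasis ℝ W).coord i) := by
    funext z
    refine ContinuousLinearMap.coe_injective ((Module.finBasis ℝ W).ext fun j => ?_)
    simp [Finsupp.single_apply]
  rw [hA]
  exact ContDiffAt.sum fun i _ => (h _).smul contDiffAt_const

/-- `polyAt p z` as an element of the space of smooth maps, depending linearly on `p`. -/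
noncomputable def polyAtLin (n : ℕ) (z : E) : (E [×n]→L[ℝ] F) →ₗ[ℝ] smoothMaps E F where
  toFun p := ⟨polyAt p z, contDiff_polyAt p z⟩
  map_add' _ _ := rfl
  map_smul' _ _ := rfl

/-- The Taylor polynomial of degree `k` of `f` at `z` has the same derivatives at `z` as `f` up to
order `k`. -/
theorem iteratedFDeriv_taylorPolynomial [CompleteSpace F] {f : E → F} {z : E} {k j : ℕ}
    (hf : ContDiffAt ℝ ∞ f z) (hj : j ≤ k) :
    iteratedFDeriv ℝ j (fun w => ∑ i ∈ Finset.range (k + 1),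
      (i.factorial : ℝ)⁻¹ • polyAt (iteratedFDeriv ℝ i f z) z w) z = iteratedFDeriv ℝ j f z := by
  rw [iteratedFDeriv_fun_sum_apply fun i _ =>
    ((contDiff_polyAt _ z).contDiffAt.const_smul _).of_le (by exact_mod_cast le_top)]
  have h1 : ∀ i, iteratedFDeriv ℝ j (fun w => (i.factorial : ℝ)⁻¹ •
      polyAt (iteratedFDeriv ℝ i f z) z w) z =
      (i.factorial : ℝ)⁻¹ • iteratedFDeriv ℝ j (polyAt (iteratedFDeriv ℝ i f z) z) z := fun i =>
    iteratedFDeriv_const_smul_apply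
      ((contDiff_polyAt _ z).contDiffAt.of_le (by exact_mod_cast le_top))
  rw [Finset.sum_eq_single j, h1, iteratedFDeriv_polyAt_of_symm, smul_smul,
    inv_mul_cancel₀ (by exact_mod_cast j.factorial_ne_zero), one_smul]
  · exact fun v σ => iteratedFDeriv_comp_perm_of_contDiffAt
      (hf.of_le (by exact_mod_cast le_top)) v σ
  · intro i _ hij
    rw [h1, iteratedFDeriv_polyAt_of_ne _ _ hij, smul_zero]
  · intro h
    exact absurd (Finset.mem_range.2 (by omega)) h

variable [FiniteDimensional ℝ E]

/-- The function `(z, w) ↦ p (w - z, …, w - z)` is a finite sum of products of functions of one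
variable. -/
theorem exists_polyAt_eq_sum {n : ℕ} (p : E [×n]→L[ℝ] F) :
    ∃ (ι : Type) (_ : Fintype ι) (α : ι → E → ℝ) (q : ι → smoothMaps E F),
      (∀ i, ContDiff ℝ ∞ (α i)) ∧ ∀ z w, polyAt p z w = ∑ i, α i z • (q i : E → F) w := by
  let b := Module.finBasis ℝ E
  let c : Fin (Module.finrank ℝ E) → E →L[ℝ] ℝ := fun i =>
    LinearMap.toContinuousLinearMap (b.coord i)
  have hc : ∀ i, ContDiff ℝ ∞ fun w => c i w := fun i => (c i).contDiff
  refine ⟨(Fin n → Fin (Module.finrank ℝ E)) × Finset (Fin n), inferInstance,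
    fun i z => ∏ j ∈ Finset.univ \ i.2, c (i.1 j) (-z),
    fun i => ⟨fun w => (∏ j ∈ i.2, c (i.1 j) w) • p fun j => b (i.1 j), ?_⟩, fun i => ?_,
    fun z w => ?_⟩
  · exact (contDiff_prod fun j _ => hc _).smul contDiff_const
  · exact contDiff_prod fun j _ => (hc _).comp contDiff_neg
  · -- Expand `w - z` in a basis, and each coordinate `c i (w - z)` as `c i w + c i (-z)`.
    have h1 : w - z = ∑ i, (c i w + c i (-z)) • b i := by
      conv_lhs => rw [← b.sum_repr (w - z)]
      refine Finset.sum_congr rfl fun i _ => ?_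
      rw [← map_add, ← sub_eq_add_neg]
      rfl
    rw [polyAt, h1, ContinuousMultilinearMap.map_sum, Fintype.sum_prod_type]
    refine Finset.sum_congr rfl fun r _ => ?_
    rw [ContinuousMultilinearMap.map_smul_univ, Finset.prod_add, Finset.sum_smul,
      Finset.powerset_univ]
    refine Finset.sum_congr rfl fun t _ => ?_
    rw [mul_comm, mul_smul]

variable [FiniteDimensional ℝ F]
  {M : Type*} [TopologicalSpace M] [ChartedSpace E M] [IsManifold 𝓘(ℝ, E) ∞ M] [T2Space M]
  {V : M → Type*} [TopologicalSpace (TotalSpace F V)]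
  [∀ x, AddCommGroup (V x)] [∀ x, Module ℝ (V x)] [∀ x, TopologicalSpace (V x)]
  [FiberBundle F V] [VectorBundle ℝ F V] [ContMDiffVectorBundle ∞ F V 𝓘(ℝ, E)]

/-- In coordinates around `x`, an operator of order at most `k` is a differential operator with
smooth coefficients. The value `P s (z)` is the value at `z` of `P` applied to the (extended)
Taylor polynomial of `s` of degree `k` at `z`; the coefficients are therefore the values of `P` on
the monomials `B (w - z, …, w - z) / i!`, which are smooth in `z` since these monomials are
finite sums of products of a function of `z` and a function of `w`. -/
theorem DiffOp.exists_coefficients {k : ℕ} (P : DiffOp E F V k) (x : M) :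
    ∃ A : (i : ℕ) → E → (E [×i]→L[ℝ] F) →L[ℝ] ℝ,
      (∀ i, ContDiffAt ℝ ∞ (A i) (extChartAt 𝓘(ℝ, E) x x)) ∧
      ∀ s, localRepFun (P.toLin s) x =ᶠ[𝓝 (extChartAt 𝓘(ℝ, E) x x)]
        jetEval A k (localRep s x) := by
  have hFc : CompleteSpace F := FiniteDimensional.complete ℝ F
  obtain ⟨L, hL⟩ := exists_sectionExtension (E := E) F V x
  let ev : E → smoothMaps E F →ₗ[ℝ] ℝ := fun z =>
    { toFun := fun g => localRepFun (P.toLin (L g)) x z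
      map_add' := fun g g' => by rw [map_add, map_add]; rfl
      map_smul' := fun c g => by rw [map_smul, map_smul]; rfl }
  refine ⟨fun i z => LinearMap.toContinuousLinearMap
    ((i.factorial : ℝ)⁻¹ • (ev z ∘ₗ polyAtLin i z)), fun i => ?_, fun s => ?_⟩
  · refine contDiffAt_dual_of_apply (W := E [×i]→L[ℝ] F) fun p => ?_
    obtain ⟨ι, _, α, q, hα, hq⟩ := exists_polyAt_eq_sum p
    have h1 : ∀ z, ev z (polyAtLin i z p) = ∑ j, α j z * ev z (q j) := by
      intro z
      have : polyAtLin i z p = ∑ j, α j z • q j := by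
        ext w
        rw [AddSubmonoidClass.coe_finsetSum, Finset.sum_apply]
        exact hq z w
      rw [this, map_sum]
      simp
    have h2 : ContDiffAt ℝ ∞ (fun z => (i.factorial : ℝ)⁻¹ * ∑ j, α j z * ev z (q j))
        (extChartAt 𝓘(ℝ, E) x x) :=
      contDiffAt_const.mul (ContDiffAt.sum fun j _ =>
        (hα j).contDiffAt.mul (contDiffAt_localRepFun (P.toLin (L (q j))) x))
    refine h2.congr_of_eventuallyEq (Filter.Eventually.of_forall fun z => ?_)
    change (i.factorial : ℝ)⁻¹ * ev z (polyAtLin i z p) = _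
    rw [h1]
  · filter_upwards [hL.eventually_nhds, eventually_contDiffAt_localRep s x,
      extChartAt_target_mem_nhds x,
      eventually_symm_mem (E := E) (extChartAt_source_mem_nhds (I := 𝓘(ℝ, E)) x),
      eventually_symm_mem (E := E) ((trivializationAt F V x).open_baseSet.mem_nhds
        (mem_baseSet_trivializationAt F V x))] with z h1 h2 h3 h4 h5
    let g : smoothMaps E F := ∑ i ∈ Finset.range (k + 1),
      (i.factorial : ℝ)⁻¹ • polyAtLin i z (iteratedFDeriv ℝ i (localRep s x) z)
    have hg : (g : E → F) = fun w => ∑ i ∈ Finset.range (k + 1),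
        (i.factorial : ℝ)⁻¹ • polyAt (iteratedFDeriv ℝ i (localRep s x) z) z w := by
      funext w
      simp only [g, AddSubmonoidClass.coe_finsetSum, Finset.sum_apply]
      rfl
    have hg' : ContDiff ℝ ∞ (g : E → F) := g.2
    have hmem : s - L g ∈ vanishing E F V k ((extChartAt 𝓘(ℝ, E) x).symm z) := by
      refine mem_vanishing_of_vanishesToOrder _ h4 h5 ?_
      rw [(extChartAt 𝓘(ℝ, E) x).right_inv h3]
      have h6 : VanishesToOrder k (fun w => localRep s x w - (g : E → F) w) z := by
        intro j hj
        have := iteratedFDeriv_sub_apply (i := j) (h2.of_le (by exact_mod_cast le_top))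
          (hg'.contDiffAt.of_le (by exact_mod_cast le_top))
        refine this.trans ?_
        rw [hg, iteratedFDeriv_taylorPolynomial h2 hj, sub_self]
      refine h6.congr ?_
      filter_upwards [h1] with w hw
      rw [← hw g]
      exact (map_sub ((trivializationAt F V x).continuousLinearMapAt ℝ _) _ _).symm
    have h7 := P.order_le _ _ hmem
    rw [map_sub] at h7
    have h8 : localRepFun (P.toLin s) x z = ev z g := sub_eq_zero.1 h7
    rw [h8, map_sum]
    refine Finset.sum_congr rfl fun i _ => ?_
    rw [map_smul]
    rfl

end Coefficients

/-! ### Prolongation of the symbol -/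

section Prolongation

variable {E : Type*} [NormedAddCommGroup E] [NormedSpace ℝ E] [FiniteDimensional ℝ E]
  {F : Type*} [NormedAddCommGroup F] [NormedSpace ℝ F]

theorem exists_smoothMap_eventuallyEq {h : E → F} {a : E}
    (hh : ∀ᶠ z in 𝓝 a, ContDiffAt ℝ ∞ h z) : ∃ g : smoothMaps E F, (g : E → F) =ᶠ[𝓝 a] h := by
  obtain ⟨ε, hε, hb⟩ := Metric.eventually_nhds_iff_ball.1 hh
  let ρ : ContDiffBump a := ⟨ε / 3, ε / 2, by positivity, by linarith⟩
  refine ⟨⟨fun z => ρ z • h z,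
    show ContDiff ℝ ∞ _ from contDiff_iff_contDiffAt.2 fun z => ?_⟩, ?_⟩
  · by_cases hz : z ∈ tsupport ρ
    · have hz' : z ∈ Metric.closedBall a (ε / 2) := by
        have := ρ.tsupport_eq
        rw [this] at hz
        exact hz
      exact ρ.contDiff.contDiffAt.smul
        (hb z (Metric.closedBall_subset_ball (by linarith) hz'))
    · refine (contDiffAt_const (c := (0 : F))).congr_of_eventuallyEq ?_
      filter_upwards [notMem_tsupport_iff_eventuallyEq.1 hz] with w hw
      rw [hw, Pi.zero_apply, zero_smul]
  · filter_upwards [ρ.eventuallyEq_one] with z hz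
    rw [hz, Pi.one_apply, one_smul]

variable {M : Type*} [TopologicalSpace M] [ChartedSpace E M] [IsManifold 𝓘(ℝ, E) ∞ M] [T2Space M]
  {V : M → Type*} [TopologicalSpace (TotalSpace F V)]
  [∀ x, AddCommGroup (V x)] [∀ x, Module ℝ (V x)] [∀ x, TopologicalSpace (V x)]
  [FiberBundle F V] [VectorBundle ℝ F V] [ContMDiffVectorBundle ∞ F V 𝓘(ℝ, E)]

variable (V) in
/-- Every germ of a smooth function in the chart at `x` is the coordinate expression of a global
section. -/
theorem exists_localRep_eventuallyEq {x : M} {h : E → F}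
    (hh : ∀ᶠ z in 𝓝 (extChartAt 𝓘(ℝ, E) x x), ContDiffAt ℝ ∞ h z) :
    ∃ t : Sec E F V, localRep t x =ᶠ[𝓝 (extChartAt 𝓘(ℝ, E) x x)] h := by
  obtain ⟨L, hL⟩ := exists_sectionExtension (E := E) F V x
  obtain ⟨g, hg⟩ := exists_smoothMap_eventuallyEq hh
  refine ⟨L g, ?_⟩
  filter_upwards [hL, hg] with z h1 h2
  rw [h1 g, h2]

namespace LinEq

variable {k : ℕ} {Q : LinEq E F V k}

/-- The symbol of the prolongation is the prolongation of the symbol: if `s` represents an element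
of the kernel of `E_{i+2} → E_{i+1}`, then its derivatives in the coordinate directions represent
elements of the kernel of `E_{i+1} → E_i`. Indeed `P (∂s) = ∂ (P s) - (∂P) s`, and `(∂P) s`
vanishes to high order since `s` does. -/
theorem ProjInjective.succ [FiniteDimensional ℝ F] {i : ℕ} (h : Q.ProjInjective i) :
    Q.ProjInjective (i + 1) := by
  rw [projInjective_iff] at h ⊢
  intro x s hs hv
  have hf := contDiffAt_localRep s x
  rw [mem_vanishing_iff, vanishesToOrder_succ_iff_forall_apply hf] at hv ⊢
  refine ⟨hv.1, fun e => ?_⟩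
  obtain ⟨t, ht⟩ := exists_localRep_eventuallyEq V (x := x)
    (h := fun z => fderiv ℝ (localRep s x) z e) (by
      filter_upwards [eventually_contDiffAt_localRep s x] with z hz
      exact contDiffAt_fderiv_apply hz e)
  refine VanishesToOrder.congr (h x t ?_ ((hv.2 e).congr ht.symm)) ht
  intro P hP r hr
  obtain ⟨A, hA, hPA⟩ := P.exists_coefficients x
  have hA' : ∀ j, ContDiffAt ℝ ∞ (fun y => fderiv ℝ (A j) y e) (extChartAt 𝓘(ℝ, E) x x) :=
    fun j => contDiffAt_fderiv_apply (hA j) e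
  have h1 : VanishesToOrder (r + 1) (jetEval A k (localRep s x)) (extChartAt 𝓘(ℝ, E) x x) :=
    VanishesToOrder.congr (hs P hP (r + 1) (by omega)) (hPA s)
  rw [vanishesToOrder_succ_iff_forall_apply (contDiffAt_jetEval hA hf)] at h1
  have hv' : VanishesToOrder (r + k) (localRep s x) (extChartAt 𝓘(ℝ, E) x x) :=
    ((vanishesToOrder_succ_iff_forall_apply hf).2 hv).mono (by omega)
  refine ((h1.2 e).sub (contDiffAt_fderiv_apply (contDiffAt_jetEval hA hf) e)
    (contDiffAt_jetEval hA' hf) (hv'.jetEval hA' hf)).congr ?_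
  filter_upwards [hPA t, jetEval_congr (A := A) (n := k) ht, fderiv_jetEval (n := k) hA hf e]
    with z h2 h3 h4
  rw [h2, h3, h4, add_sub_cancel_left]

theorem ProjInjective.of_le [FiniteDimensional ℝ F] {l i : ℕ} (h : Q.ProjInjective l)
    (hli : l ≤ i) : Q.ProjInjective i := by
  induction i, hli using Nat.le_induction with
  | base => exact h
  | succ i _ ih => exact ih.succ

end LinEq

end Prolongation

/-! ### Unique continuation -/

section Uniqueness

variable {E : Type*} [NormedAddCommGroup E] [NormedSpace ℝ E]
  {F : Type*} [NormedAddCommGroup F] [NormedSpace ℝ F]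

/-- Grönwall: if the derivative of order `l + 1` of `f` is bounded by those of lower order on a
ball, then `f` is determined there by its derivatives of order at most `l` at any point. -/
theorem eqOn_zero_of_norm_iteratedFDeriv_le {f : E → F} {a : E} {ε C : ℝ} {l : ℕ}
    (hf : ∀ z ∈ Metric.ball a ε, ContDiffAt ℝ ∞ f z)
    (hC : ∀ z ∈ Metric.ball a ε, ‖iteratedFDeriv ℝ (l + 1) f z‖ ≤
      C * ∑ j ∈ Finset.range (l + 1), ‖iteratedFDeriv ℝ j f z‖)
    {y : E} (hy : y ∈ Metric.ball a ε) (hfy : VanishesToOrder l f y) :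
    ∀ w ∈ Metric.ball a ε, f w = 0 := by
  intro w hw
  let γ : ℝ → E := fun τ => y + τ • (w - y)
  have hγ : ∀ τ ∈ Set.Icc (0 : ℝ) 1, γ τ ∈ Metric.ball a ε := fun τ hτ =>
    (convex_ball a ε).add_smul_sub_mem hy hw hτ
  have hγ' : ∀ τ, HasDerivAt γ (w - y) τ := fun τ => by
    have := ((hasDerivAt_id τ).smul_const (w - y)).const_add y
    rwa [one_smul] at this
  -- Grönwall's inequality is applied to the vector of all derivatives of order at most `l` along the
  -- segment from `y` to `w`: the last component is controlled by `hC`, the others by their successor.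
  let h : ℝ → (j : Fin (l + 1)) → E [×j]→L[ℝ] F := fun τ j => iteratedFDeriv ℝ j f (γ τ)
  let h' : ℝ → (j : Fin (l + 1)) → E [×j]→L[ℝ] F := fun τ j =>
    fderiv ℝ (iteratedFDeriv ℝ j f) (γ τ) (w - y)
  have hd : ∀ τ ∈ Set.Icc (0 : ℝ) 1, HasDerivAt h (h' τ) τ := fun τ hτ =>
    hasDerivAt_pi.2 fun j =>
      (((contDiffAt_iteratedFDeriv (hf _ (hγ τ hτ)) j).differentiableAt
        (by simp)).hasFDerivAt).comp_hasDerivAt τ (hγ' τ)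
  have hK : ∀ τ ∈ Set.Icc (0 : ℝ) 1,
      ‖h' τ‖ ≤ ((1 + |C| * (l + 1)) * ‖w - y‖) * ‖h τ‖ := by
    intro τ hτ
    refine (pi_norm_le_iff_of_nonneg (by positivity)).2 fun j => ?_
    have h1 : ‖h' τ j‖ ≤ ‖iteratedFDeriv ℝ (j + 1) f (γ τ)‖ * ‖w - y‖ := by
      rw [← norm_fderiv_iteratedFDeriv]
      exact ContinuousLinearMap.le_opNorm _ _
    have h2 : ‖iteratedFDeriv ℝ (j + 1) f (γ τ)‖ ≤ (1 + |C| * (l + 1)) * ‖h τ‖ := by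
      rcases Nat.lt_or_ge (j + 1) (l + 1) with hj | hj
      · have h3 : ‖iteratedFDeriv ℝ (j + 1) f (γ τ)‖ ≤ ‖h τ‖ := norm_le_pi_norm (h τ) ⟨j + 1, hj⟩
        have h4 : 0 ≤ |C| * (l + 1) * ‖h τ‖ := by positivity
        linarith
      · have hj' : (j : ℕ) = l := by omega
        have h5 : ∑ i ∈ Finset.range (l + 1), ‖iteratedFDeriv ℝ i f (γ τ)‖ ≤
            (l + 1) * ‖h τ‖ := by
          have := Finset.sum_le_card_nsmul (Finset.range (l + 1))
            (fun i => ‖iteratedFDeriv ℝ i f (γ τ)‖) ‖h τ‖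
            fun i hi => norm_le_pi_norm (h τ) ⟨i, Finset.mem_range.1 hi⟩
          simpa using this
        have h6 : 0 ≤ ∑ i ∈ Finset.range (l + 1), ‖iteratedFDeriv ℝ i f (γ τ)‖ :=
          Finset.sum_nonneg fun i _ => norm_nonneg _
        rw [hj']
        calc ‖iteratedFDeriv ℝ (l + 1) f (γ τ)‖
            ≤ C * ∑ i ∈ Finset.range (l + 1), ‖iteratedFDeriv ℝ i f (γ τ)‖ := hC _ (hγ τ hτ)
          _ ≤ |C| * ∑ i ∈ Finset.range (l + 1), ‖iteratedFDeriv ℝ i f (γ τ)‖ :=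
              mul_le_mul_of_nonneg_right (le_abs_self C) h6
          _ ≤ |C| * ((l + 1) * ‖h τ‖) := mul_le_mul_of_nonneg_left h5 (abs_nonneg C)
          _ ≤ (1 + |C| * (l + 1)) * ‖h τ‖ := by nlinarith [norm_nonneg (h τ)]
    calc ‖h' τ j‖ ≤ ‖iteratedFDeriv ℝ (j + 1) f (γ τ)‖ * ‖w - y‖ := h1
      _ ≤ ((1 + |C| * (l + 1)) * ‖h τ‖) * ‖w - y‖ := by gcongr
      _ = _ := by ring
  have h0 : h 0 = 0 := by
    funext j
    have : γ 0 = y := by simp [γ]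
    change iteratedFDeriv ℝ j f (γ 0) = 0
    rw [this]
    exact hfy j (by omega)
  have h1 := eq_zero_of_abs_deriv_le_mul_abs_self_of_eq_zero_right
    (fun τ hτ => (hd τ hτ).continuousAt.continuousWithinAt)
    (fun τ hτ => (hd τ (Set.Ico_subset_Icc_self hτ)).hasDerivWithinAt) h0
    (fun τ hτ => hK τ (Set.Ico_subset_Icc_self hτ)) 1 (by simp)
  have h2 : iteratedFDeriv ℝ 0 f (γ 1) = 0 := congrFun h1 0
  rw [iteratedFDeriv_zero_eq_zero_iff] at h2
  simpa [γ] using h2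

/-- If suitably scaled jets of `f` at points tending to `a` converge to the jet of `t` at `a`, then
every differential operator annihilating `f` also annihilates `t` at `a`, together with the
derivatives that involve only this jet. -/
theorem vanishesToOrder_jetEval_of_tendsto [FiniteDimensional ℝ E] [FiniteDimensional ℝ F]
    {ι : Type*} {p : Filter ι} [p.NeBot] {z : ι → E} {c : ι → ℝ} {a : E} {f t : E → F}
    (hz : Filter.Tendsto z p (𝓝 a)) (hf : ContDiffAt ℝ ∞ f a) (ht : ContDiffAt ℝ ∞ t a) {m : ℕ}
    (hj : ∀ j ≤ m, Filter.Tendsto (fun i => c i • iteratedFDeriv ℝ j f (z i)) p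
      (𝓝 (iteratedFDeriv ℝ j t a)))
    {A : (i : ℕ) → E → (E [×i]→L[ℝ] F) →L[ℝ] ℝ} (hA : ∀ i, ContDiffAt ℝ ∞ (A i) a)
    {n r : ℕ} (hnr : n + r ≤ m) (h0 : jetEval A n f =ᶠ[𝓝 a] 0) :
    VanishesToOrder r (jetEval A n t) a := by
  induction r generalizing A n with
  | zero =>
    rw [vanishesToOrder_zero_iff]
    have h1 : Filter.Tendsto (fun i => c i * jetEval A n f (z i)) p (𝓝 (jetEval A n t a)) := by
      simp only [jetEval, Finset.mul_sum]
      refine tendsto_finsetSum _ fun i hi => ?_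
      have h2 : Filter.Tendsto (fun q => A i (z q)) p (𝓝 (A i a)) :=
        (hA i).continuousAt.tendsto.comp hz
      have h3 := (isBoundedBilinearMap_apply.continuous.tendsto
        (A i a, iteratedFDeriv ℝ i t a)).comp
        (h2.prodMk_nhds (hj i (by have := Finset.mem_range.1 hi; omega)))
      simpa [Function.comp_def] using h3
    have h4 : (fun i => c i * jetEval A n f (z i)) =ᶠ[p] fun _ => 0 := by
      filter_upwards [hz.eventually h0] with i hi
      rw [hi, Pi.zero_apply, mul_zero]
    exact tendsto_nhds_unique h1 ((Filter.tendsto_congr' h4).2 tendsto_const_nhds)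
  | succ r ih =>
    rw [vanishesToOrder_succ_iff_forall_apply (contDiffAt_jetEval hA ht)]
    refine ⟨(ih hA (n := n) (by omega) h0).apply_eq_zero, fun e => ?_⟩
    refine (ih (n := n + 1) (contDiffAt_derivCoeff hA n e) (by omega) ?_).congr
      (fderiv_jetEval_eq_jetEval_derivCoeff hA ht e).symm
    refine (fderiv_jetEval_eq_jetEval_derivCoeff hA hf e).symm.trans ?_
    filter_upwards [h0.eventuallyEq_nhds] with w hw
    rw [hw.fderiv_eq]
    simp

variable [FiniteDimensional ℝ E] [FiniteDimensional ℝ F]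
  {M : Type*} [TopologicalSpace M] [ChartedSpace E M] [IsManifold 𝓘(ℝ, E) ∞ M] [T2Space M]
  {V : M → Type*} [TopologicalSpace (TotalSpace F V)]
  [∀ x, AddCommGroup (V x)] [∀ x, Module ℝ (V x)] [∀ x, TopologicalSpace (V x)]
  [FiberBundle F V] [VectorBundle ℝ F V] [ContMDiffVectorBundle ∞ F V 𝓘(ℝ, E)]

namespace LinEq

variable {k : ℕ} {Q : LinEq E F V k}

/-- Near every point, the derivatives of order `l + 1` of a solution are bounded by those of lower
order. Otherwise normalized jets of the solution would converge to a nonzero homogeneous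
`l + 1`-jet that satisfies the equations, an element of the kernel of `E_{l+1} → E_l`. -/
theorem exists_norm_iteratedFDeriv_le {l : ℕ} (hinj : Q.ProjInjective l)
    {s : Sec E F V} (hs : s ∈ Q.Sol) (x : M) :
    ∃ C : ℝ, ∀ᶠ z in 𝓝 (extChartAt 𝓘(ℝ, E) x x),
      ‖iteratedFDeriv ℝ (l + 1) (localRep s x) z‖ ≤
        C * ∑ j ∈ Finset.range (l + 1), ‖iteratedFDeriv ℝ j (localRep s x) z‖ := by
  by_contra! hcon
  have hFc : CompleteSpace F := FiniteDimensional.complete ℝ F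
  set a := extChartAt 𝓘(ℝ, E) x x with ha
  set f := localRep s x with hfdef
  have hf : ContDiffAt ℝ ∞ f a := contDiffAt_localRep s x
  have hsmooth := eventually_contDiffAt_localRep s x
  -- Points tending to `a` at which the top derivative dominates the others by a growing factor.
  have hseq : ∀ n : ℕ, ∃ z : E, ContDiffAt ℝ ∞ f z ∧ dist z a < 1 / ((n : ℝ) + 1) ∧
      ((n : ℝ) + 1) * ∑ j ∈ Finset.range (l + 1), ‖iteratedFDeriv ℝ j f z‖ <
        ‖iteratedFDeriv ℝ (l + 1) f z‖ := by
    intro n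
    have h1 : ∀ᶠ z in 𝓝 a, dist z a < 1 / ((n : ℝ) + 1) :=
      Metric.ball_mem_nhds a Nat.one_div_pos_of_nat
    obtain ⟨z, hz1, hz2, hz3⟩ := ((hcon ((n : ℝ) + 1)).and_eventually (h1.and hsmooth)).exists
    exact ⟨z, hz3, hz2, hz1⟩
  choose z hzs hzd hzn using hseq
  have hza : Filter.Tendsto z Filter.atTop (𝓝 a) := by
    rw [tendsto_iff_dist_tendsto_zero]
    exact squeeze_zero (fun n => dist_nonneg) (fun n => (hzd n).le)
      tendsto_one_div_add_atTop_nhds_zero_nat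
  let N : ℕ → ℝ := fun n => ‖iteratedFDeriv ℝ (l + 1) f (z n)‖
  have hN : ∀ n, 0 < N n := fun n => lt_of_le_of_lt
    (mul_nonneg (by positivity) (Finset.sum_nonneg fun _ _ => norm_nonneg _)) (hzn n)
  have hunit : ∀ n, (N n)⁻¹ • iteratedFDeriv ℝ (l + 1) f (z n) ∈
      Metric.sphere (0 : E [×(l + 1)]→L[ℝ] F) 1 := by
    intro n
    rw [mem_sphere_zero_iff_norm, norm_smul, norm_inv, Real.norm_of_nonneg (hN n).le]
    exact inv_mul_cancel₀ (hN n).ne'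
  have hproper : ProperSpace (E [×(l + 1)]→L[ℝ] F) := FiniteDimensional.proper ℝ _
  -- The limit `B` of the normalized top derivatives is the homogeneous jet to be contradicted.
  obtain ⟨B, hB, φ, hφ, hlim⟩ := (isCompact_sphere _ _).tendsto_subseq hunit
  have hlow : ∀ j ≤ l, Filter.Tendsto (fun n => (N n)⁻¹ • iteratedFDeriv ℝ j f (z n))
      Filter.atTop (𝓝 0) := by
    intro j hj
    refine squeeze_zero_norm (fun n => ?_) tendsto_one_div_add_atTop_nhds_zero_nat
    rw [norm_smul, norm_inv, Real.norm_of_nonneg (hN n).le, inv_mul_le_iff₀ (hN n),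
      mul_one_div, le_div_iff₀ (by positivity)]
    have h1 : ‖iteratedFDeriv ℝ j f (z n)‖ ≤
        ∑ j ∈ Finset.range (l + 1), ‖iteratedFDeriv ℝ j f (z n)‖ :=
      Finset.single_le_sum (f := fun j => ‖iteratedFDeriv ℝ j f (z n)‖)
        (fun _ _ => norm_nonneg _) (Finset.mem_range.2 (by omega))
    have h2 := hzn n
    have h3 : (0 : ℝ) ≤ n := n.cast_nonneg
    change _ ≤ ‖iteratedFDeriv ℝ (l + 1) f (z n)‖
    nlinarith
  have hsymm : ∀ v (σ : Equiv.Perm (Fin (l + 1))), B (v ∘ σ) = B v := by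
    intro v σ
    have h1 := ((ContinuousMultilinearMap.apply ℝ (fun _ : Fin (l + 1) => E) F
      (v ∘ σ)).continuous.tendsto B).comp hlim
    have h2 := ((ContinuousMultilinearMap.apply ℝ (fun _ : Fin (l + 1) => E) F
      v).continuous.tendsto B).comp hlim
    refine tendsto_nhds_unique h1 (h2.congr fun n => ?_)
    simp only [Function.comp_apply, map_smul]
    congr 1
    exact (iteratedFDeriv_comp_perm_of_contDiffAt
      ((hzs (φ n)).of_le (by exact_mod_cast le_top)) v σ).symm
  have hfac : ((l + 1).factorial : ℝ) ≠ 0 := by exact_mod_cast (l + 1).factorial_ne_zero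
  have hpoly : ContDiffAt ℝ ∞ (polyAt B a) a := (contDiff_polyAt B a).contDiffAt
  -- The factor `(l + 1)!` appears since the top derivative of `B (w - a, …, w - a)` is `(l + 1)! B`.
  have hj : ∀ j ≤ l + 1, Filter.Tendsto
      (fun n => (((l + 1).factorial : ℝ) * (N (φ n))⁻¹) • iteratedFDeriv ℝ j f (z (φ n)))
      Filter.atTop (𝓝 (iteratedFDeriv ℝ j (polyAt B a) a)) := by
    intro j hj
    simp only [mul_smul]
    rcases Nat.lt_or_ge j (l + 1) with hj' | hj'
    · rw [iteratedFDeriv_polyAt_of_ne _ _ (by omega),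
        ← smul_zero ((l + 1).factorial : ℝ)]
      exact ((hlow j (by omega)).comp hφ.tendsto_atTop).const_smul _
    · obtain rfl : j = l + 1 := by omega
      rw [iteratedFDeriv_polyAt_of_symm _ _ hsymm]
      exact hlim.const_smul _
  obtain ⟨t, ht⟩ := exists_localRep_eventuallyEq V (x := x) (h := polyAt B a)
    (Filter.Eventually.of_forall fun w => (contDiff_polyAt B a).contDiffAt)
  have htv : t ∈ vanishing E F V (l + 1) x := by
    refine projInjective_iff.1 hinj x t ?_ ?_
    · intro P hP r hr
      obtain ⟨A, hA, hPA⟩ := P.exists_coefficients x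
      refine VanishesToOrder.congr (vanishesToOrder_jetEval_of_tendsto
        (hza.comp hφ.tendsto_atTop) hf hpoly hj hA hr ?_)
        ((hPA t).trans (jetEval_congr ht)).symm
      refine (hPA s).symm.trans (Filter.Eventually.of_forall fun w => ?_)
      rw [hP.toLin_eq_zero hs]
      rfl
    · refine VanishesToOrder.congr (fun j hj => ?_) ht.symm
      exact iteratedFDeriv_polyAt_of_ne _ _ (by omega)
  have h1 := VanishesToOrder.congr htv ht (l + 1) le_rfl
  rw [iteratedFDeriv_polyAt_of_symm _ _ hsymm, smul_eq_zero] at h1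
  rw [mem_sphere_zero_iff_norm, h1.resolve_left hfac, norm_zero] at hB
  exact zero_ne_one hB

/-- Near every point `x`, a solution is determined by its `l`-jet at any one point. -/
theorem exists_mem_nhds_eq_zero {l : ℕ} (hinj : Q.ProjInjective l)
    {s : Sec E F V} (hs : s ∈ Q.Sol) (x : M) :
    ∃ U ∈ 𝓝 x, U ⊆ (extChartAt 𝓘(ℝ, E) x).source ∧
      ∀ y ∈ U, VanishesToOrder l (localRep s x) (extChartAt 𝓘(ℝ, E) x y) →
        ∀ w ∈ U, s w = 0 := by
  obtain ⟨C, hC⟩ := exists_norm_iteratedFDeriv_le hinj hs x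
  obtain ⟨ε, hε, hb⟩ :=
    Metric.eventually_nhds_iff_ball.1 (hC.and (eventually_contDiffAt_localRep s x))
  refine ⟨((extChartAt 𝓘(ℝ, E) x).source ∩ (trivializationAt F V x).baseSet) ∩
    extChartAt 𝓘(ℝ, E) x ⁻¹' Metric.ball (extChartAt 𝓘(ℝ, E) x x) ε,
    Filter.inter_mem (Filter.inter_mem (extChartAt_source_mem_nhds x)
      ((trivializationAt F V x).open_baseSet.mem_nhds (mem_baseSet_trivializationAt F V x)))
      ((continuousAt_extChartAt x).preimage_mem_nhds (Metric.ball_mem_nhds _ hε)),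
    fun y hy => hy.1.1, fun y hy hv w hw => ?_⟩
  have h1 := eqOn_zero_of_norm_iteratedFDeriv_le (fun z hz => (hb z hz).2)
    (fun z hz => (hb z hz).1) hy.2 hv _ hw.2
  unfold localRep at h1
  rw [(extChartAt 𝓘(ℝ, E) x).left_inv hw.1.1] at h1
  rw [← Trivialization.symmL_continuousLinearMapAt (R := ℝ) (trivializationAt F V x) hw.1.2 (s w),
    h1, map_zero]

/-- Unique continuation: on a connected manifold a solution is determined by its `l`-jet at any
point. -/
theorem eq_zero_of_jet_eq_zero [ConnectedSpace M] {l : ℕ} (hinj : Q.ProjInjective l) {s : Sec E F V} (hs : s ∈ Q.Sol) {x : M} (hx : jet l x s = 0) :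
    s = 0 := by
  have hopen : IsOpen {y : M | ∀ᶠ w in 𝓝 y, s w = 0} := isOpen_setOfPred_eventually_nhds
  have hclosed : IsClosed {y : M | ∀ᶠ w in 𝓝 y, s w = 0} := by
    refine isClosed_of_closure_subset fun y hy => ?_
    obtain ⟨U, hU, hUs, h⟩ := exists_mem_nhds_eq_zero hinj hs y
    obtain ⟨w, hwU, hw⟩ := mem_closure_iff_nhds.1 hy U hU
    refine Filter.mem_of_superset hU (h w hwU ?_)
    refine (vanishesToOrder_zero_fun l _).congr ?_
    have hcont : Filter.Tendsto (extChartAt 𝓘(ℝ, E) y).symm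
        (𝓝 (extChartAt 𝓘(ℝ, E) y w)) (𝓝 w) := by
      have := (continuousAt_extChartAt_symm' (I := 𝓘(ℝ, E)) (hUs hwU)).tendsto
      rwa [(extChartAt 𝓘(ℝ, E) y).left_inv (hUs hwU)] at this
    filter_upwards [hcont.eventually hw] with z hz
    rw [localRep, hz, map_zero]
  have hne : {y : M | ∀ᶠ w in 𝓝 y, s w = 0}.Nonempty := by
    obtain ⟨U, hU, -, h⟩ := exists_mem_nhds_eq_zero hinj hs x
    exact ⟨x, Filter.mem_of_superset hU (h x (mem_of_mem_nhds hU) (jet_eq_zero_iff.1 hx))⟩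
  have huniv := IsClopen.eq_univ ⟨hclosed, hopen⟩ hne
  ext y
  have hy : y ∈ {y : M | ∀ᶠ w in 𝓝 y, s w = 0} := huniv ▸ Set.mem_univ y
  exact Filter.Eventually.self_of_nhds (p := fun w => s w = 0) hy

end LinEq

end Uniqueness

/-! ### Dimension of the solution space -/

section Dimension

/-- Rank-nullity for the restriction of `f` to `S`, with the ranks as extended natural numbers. -/
theorem rank_le_rank_add_rank_inf_ker.{u} {W J : Type u} [AddCommGroup W] [Module ℝ W]
    [AddCommGroup J] [Module ℝ J] (f : W →ₗ[ℝ] J) {S K : Submodule ℝ W} {T : Submodule ℝ J}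
    (hK : LinearMap.ker f = K) (h : ∀ w ∈ S, f w ∈ T) :
    Cardinal.toENat (Module.rank ℝ S) ≤
      Cardinal.toENat (Module.rank ℝ T) +
        Cardinal.toENat (Module.rank ℝ (S ⊓ K : Submodule ℝ W)) := by
  let g : S →ₗ[ℝ] T := f.restrict h
  have hker : Module.rank ℝ (LinearMap.ker g) ≤ Module.rank ℝ (S ⊓ K : Submodule ℝ W) := by
    let ι : LinearMap.ker g →ₗ[ℝ] (S ⊓ K : Submodule ℝ W) :=
      (S.subtype ∘ₗ (LinearMap.ker g).subtype).codRestrict _ fun w =>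
        ⟨w.1.2, hK ▸ congrArg Subtype.val w.2⟩
    refine LinearMap.rank_le_of_injective ι fun w w' hw => ?_
    exact Subtype.ext (Subtype.ext (congrArg (fun v : (S ⊓ K : Submodule ℝ W) => (v : W)) hw))
  rw [← map_add]
  refine Cardinal.toENat.monotone' ?_
  rw [← LinearMap.rank_range_add_rank_ker g]
  exact add_le_add (Submodule.rank_le _) hker

variable {E : Type*} [NormedAddCommGroup E] [NormedSpace ℝ E]
  {F : Type*} [NormedAddCommGroup F] [NormedSpace ℝ F]
  {M : Type*} [TopologicalSpace M] [ChartedSpace E M] [IsManifold 𝓘(ℝ, E) ∞ M]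
  {V : M → Type*} [TopologicalSpace (TotalSpace F V)]
  [∀ x, AddCommGroup (V x)] [∀ x, Module ℝ (V x)] [∀ x, TopologicalSpace (V x)]
  [FiberBundle F V] [VectorBundle ℝ F V]

namespace LinEq

variable {k : ℕ} {Q : LinEq E F V k}

theorem ker_jet (m : ℕ) (x : M) :
    LinearMap.ker (jet (E := E) (F := F) (V := V) m x) = vanishing E F V m x :=
  Submodule.ker_mkQ _

theorem jet_mem_bar {s : Sec E F V} (hs : s ∈ Q.Sol) (i : ℕ) (x : M) : jet i x s ∈ Q.bar i x := by
  simp only [bar, Submodule.mem_iInf]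
  intro m hm
  refine ⟨jet m x s, ⟨s, fun P hP r _ => ?_, rfl⟩, rfl⟩
  rw [hP.toLin_eq_zero hs]
  exact vanishesToOrder_zero_fun r _

/-- The filtration of the solutions by their order of vanishing at `x` has its graded pieces
inside the spaces `ḡ_i(x)`. -/
theorem rank_sol_le (n : ℕ) (x : M) :
    Cardinal.toENat (Module.rank ℝ Q.Sol) ≤
      ∑ i ∈ Finset.range (n + 1), Cardinal.toENat (Module.rank ℝ (Q.barSymbol i x)) +
        Cardinal.toENat (Module.rank ℝ (Q.Sol ⊓ vanishing E F V n x : Submodule ℝ _)) := by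
  induction n with
  | zero =>
    rw [zero_add, Finset.sum_range_one]
    exact rank_le_rank_add_rank_inf_ker _ (ker_jet 0 x) fun s hs => jet_mem_bar hs 0 x
  | succ n ih =>
    refine ih.trans ?_
    rw [Finset.sum_range_succ _ (n + 1), add_assoc]
    gcongr
    have h := rank_le_rank_add_rank_inf_ker (jet (n + 1) x) (ker_jet _ x) (S := Q.Sol ⊓ vanishing E F V n x)
      (T := Q.barSymbol (n + 1) x) fun s hs =>
        ⟨jet_mem_bar hs.1 _ x, jet_eq_zero_iff.2 hs.2⟩
    rwa [inf_assoc, inf_eq_right.2 (vanishing_anti E F V n.le_succ x)] at h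

end LinEq

end Dimension

end LinearPDE

theorem mainTheorem7
    {E : Type*} [NormedAddCommGroup E] [NormedSpace ℝ E] [FiniteDimensional ℝ E]
    {M : Type*} [TopologicalSpace M] [ChartedSpace E M] [IsManifold 𝓘(ℝ, E) ∞ M]
    [T2Space M] [ConnectedSpace M]
    {F : Type*} [NormedAddCommGroup F] [NormedSpace ℝ F] [FiniteDimensional ℝ F]
    {V : M → Type*} [TopologicalSpace (TotalSpace F V)]
    [∀ x, AddCommGroup (V x)] [∀ x, Module ℝ (V x)] [∀ x, TopologicalSpace (V x)]
    [FiberBundle F V] [VectorBundle ℝ F V] [ContMDiffVectorBundle ∞ F V 𝓘(ℝ, E)]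
    {k : ℕ} (Q : LinearPDE.LinEq E F V k)
    (l : ℕ) (hkl : k ≤ l + 1) (hinj : Q.ProjInjective l) :
    (∀ i, l ≤ i → Q.ProjInjective i) ∧
    (∀ s ∈ Q.Sol, ∀ x : M, (∀ m : ℕ, LinearPDE.jet m x s = 0) → s = 0) ∧
    Cardinal.toENat (Module.rank ℝ Q.Sol) ≤
      ⨅ x : M, ∑' i : ℕ, Cardinal.toENat (Module.rank ℝ (Q.barSymbol i x)) := by
  refine ⟨fun i hi => hinj.of_le hi,
    fun s hs x h => LinearPDE.LinEq.eq_zero_of_jet_eq_zero hinj hs (h l), le_iInf fun x => ?_⟩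
  have hbot : Q.Sol ⊓ LinearPDE.vanishing E F V l x = ⊥ := (Submodule.eq_bot_iff _).2 fun s hs =>
    LinearPDE.LinEq.eq_zero_of_jet_eq_zero hinj hs.1 (LinearPDE.jet_eq_zero_iff.2 hs.2)
  have h := LinearPDE.LinEq.rank_sol_le (Q := Q) l x
  rw [hbot, rank_bot, map_zero, add_zero] at h
  have hsum : Summable fun i => Cardinal.toENat (Module.rank ℝ (Q.barSymbol i x)) :=
    (hasSum_of_isLUB _ (isLUB_iSup)).summable
  exact h.trans (hsum.sum_le_tsum _ fun _ _ => zero_le)
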